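/- Let $d\ge 1$ and $p\ge 1$ be integers and $\mathcal H=[-\tfrac12,\tfrac12)^d$. Let $\mathbf x_1,\mathbf x_2,\dots$ be i.i.d. random vectors in $\mathcal H$ having a continuous distribution with probability density $f_x$ on $\mathcal H$, and for $k\ge1$ put $I_k=\int_{\mathcal H} f_x(\mathbf z)^k\,d\mathbf z$; assume $I_p<\infty$ (which holds for every $p$ if $f_x$ is bounded, in particular if $f_x$ is continuous on the closed cube; the function $f_x$ itself need not be continuous). For positive integers $n,m$ let $\mathbf V$ be the $n^d\times m$ $d$-fold Vandermonde matrix with rows indexed by $\boldsymbol\ell\in\{0,\dots,n-1\}^d$, columns indexed by $q=1,\dots,m$, and entries $$\mathbf V_{\boldsymbol\ell,q}=m^{-1/2}\exp\left(-2\pi \mathrm i\,\boldsymbol\ell^{\mathsf T}\mathbf x_q\right).$$ For $1\le k\le p$ let $\Omega_{p,k}$ be the set of partitions of $\{1,\dots,p\}$ into $k$ nonempty blocks. For $\omega\in\Omega_{p,k}$ let $\omega_i\in\{1,\dots,k\}$ be the index of the block containing $i$, where $\omega_{p+1}=\omega_1$. Then the limit $$v(\omega)=\lim_{n\to\infty}\frac{1}{n^{p-k+1}}\int_{[-1/2,1/2)^k}\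 \prod_{i=1}^p\Big(\sum_{\ell=0}^{n-1}e^{2\pi \mathrm i\ell(y_{\omega_i}-y_{\omega_{i+1}})}\Big)\,dy_1\cdots dy_k$$ exists and is real, and, whenever $n,m\to\infty$ with $n^d/m\to\beta$ for some $0<\beta<\infty$, the $p$-th asymptotic moment of $\mathbf V\mathbf V^{\mathsf H}$ exists and equals $$\lim_{n,m\to\infty}\mathbb E\left[\frac1{n^d}\operatorname{Tr}\left(\left(\mathbf V\mathbf V^{\mathsf H}\right)^p\right)\right]=\sum_{k=1}^p\beta^{p-k}\,I_k\sum_{\omega\in\Omega_{p,k}}v(\omega)^d .$$ -/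

import Mathlib

open MeasureTheory ProbabilityTheory Filter Topology

noncomputable section

namespace RandomVandermonde

/-- The half-open cube `[-1/2, 1/2)^d`. -/
def cube (d : ℕ) : Set (Fin d → ℝ) :=
  Set.univ.pi fun _ => Set.Ico (-1 / 2 : ℝ) (1 / 2)

/-- The `d`-fold Vandermonde matrix with `n ^ d` rows and `m` columns built from the sample points
`x 0, …, x (m - 1)`. Its rows are labelled by the multi-indices `ℓ ∈ {0, …, n - 1}^d`, and its
entries are `m ^ (-1/2) * exp (-2 π i ⟨ℓ, x q⟩)`. -/
def vandermonde (d n m : ℕ) (x : ℕ → Fin d → ℝ) : Matrix (Fin d → Fin n) (Fin m) ℂ :=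
  Matrix.of fun ℓ q =>
    (((Real.sqrt m)⁻¹ : ℝ) : ℂ) *
      Complex.exp (-2 * Real.pi * Complex.I * ((∑ j, ((ℓ j : ℕ) : ℝ) * x q j : ℝ) : ℂ))

/-- The expected normalized trace `E[(1 / n^d) Tr ((V Vᴴ)^p)]`, that is, the `p`-th moment of the
average empirical eigenvalue distribution of `V Vᴴ`. -/
def moment {Ω : Type*} [MeasurableSpace Ω] (P : Measure Ω) (d p n m : ℕ)
    (x : ℕ → Ω → Fin d → ℝ) : ℂ :=
  ∫ a, (((n : ℂ) ^ d)⁻¹ *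
    Matrix.trace ((vandermonde d n m (fun q => x q a) *
      (vandermonde d n m (fun q => x q a)).conjTranspose) ^ p)) ∂P

/-- Partitions of a `p`-element set into nonempty blocks. -/
abbrev Partition (p : ℕ) : Type := Finpartition (Finset.univ : Finset (Fin p))

/-- The set of partitions of a `p`-element set into `k` blocks. -/
def partitionsInto (p k : ℕ) : Finset (Partition p) :=
  Finset.univ.filter fun ω => ω.parts.card = k

/-- The block of `ω` that contains `i`. -/
def block {p : ℕ} (ω : Partition p) (i : Fin p) : ω.parts :=
  ⟨ω.part i, ω.part_mem.2 (Finset.mem_univ i)⟩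

/-- `∑_{ℓ=0}^{n-1} exp (2 π i ℓ t)`, which is `(1 - exp (2 π i n t)) / (1 - exp (2 π i t))`
for `t ∉ ℤ` and `n` for `t ∈ ℤ`. -/
def expSum (n : ℕ) (t : ℝ) : ℂ :=
  ∑ ℓ ∈ Finset.range n, Complex.exp (2 * Real.pi * Complex.I * ((ℓ : ℝ) * t : ℝ))

/-- `F_ω(y) = ∏_i expSum (y_{ω(i)} - y_{ω(i+1)})`, with one real variable for each block of `ω`,
where `ω(i)` is the block containing `i` and `i + 1` is taken cyclically. -/
def cyclicKernel {p : ℕ} (ω : Partition p) (n : ℕ) (y : ω.parts → ℝ) : ℂ :=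
  ∏ i : Fin p, expSum n (y (block ω i) - y (block ω (finRotate p i)))

/-- The normalized mean of `F_ω` over uniform points of `[-1/2, 1/2)`, for `ω` with `k` blocks:
`n ^ (-(p - k + 1)) ∫_{[-1/2,1/2)^k} F_ω`. As `F_ω` is periodic and depends only on differences of
the variables, one of the `k` variables may equally well be kept fixed. -/
def uniformMean {p : ℕ} (ω : Partition p) (n : ℕ) : ℂ :=
  (∫ y in (Set.univ.pi fun _ : ω.parts => Set.Ico (-1 / 2 : ℝ) (1 / 2)), cyclicKernel ω n y) /
    (n : ℂ) ^ (p - ω.parts.card + 1)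

/-- The coefficient `v(ω)`: the limit of `uniformMean ω n` as `n → ∞`. -/
def coeff {p : ℕ} (ω : Partition p) : ℝ :=
  (limUnder atTop (uniformMean ω)).re

/-- `I_k = ∫ f^k` over the cube. -/
def powerIntegral (d : ℕ) (f : (Fin d → ℝ) → ℝ) (k : ℕ) : ℝ :=
  ∫ z in cube d, f z ^ k

end RandomVandermonde

end

noncomputable section

namespace RandomVandermonde

/-! ### Transfer to the torus -/

/-! The trace of `(V Vᴴ) ^ p` equals that of `(Vᴴ V) ^ p`, and the entries of `Vᴴ V` are `1 / m`
times products of one-dimensional exponential sums at differences of sample points. Expanding the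
trace over closed walks in the sample indices and sorting the walks by their level-set partition
`ω`, every injective labelling of the `k` blocks has the same expectation, and there are `m (m - 1)
⋯ (m - k + 1)` labellings (`moment_eq`). With `n ^ d / m → β`, it remains to show for each `ω` that
the kernel integrated against the product density, divided by `n ^ (d (p - k + 1))`, tends to `I_k *
v(ω) ^ d`.

For uniform points, orthogonality of characters turns the kernel integral into the number of integer
circulations on the closed walk of `ω` with values in `[0, n)` (`integral_prod_dirichlet`). The
circulations form a lattice of rank `p - k + 1`, so the normalized count tends to the volume of a
bounded convex set (`exists_tendsto_card_ker_div_pow`). Hence `v(ω)` exists and is real, and the `d`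
coordinates contribute independent factors.

For a general density `F`, the kernel is invariant under a common translation of all points, so `∏ F
(z_B)` may be replaced by its average over such translations, `diagonalMean F z`. This average is
bounded and tends to `∫ F ^ k` near the diagonal, using only integrability of `F` and `F ^ k`
(`exists_abs_diagonalMean_sub_le`).

What remains is concentration of the kernel near the diagonal, in absolute value and without a
logarithmic loss. Each factor is at most a multiple of `n / (1 + n ‖t‖)`, whose integral is of order
`log n`. A closed walk stays connected after losing any one step, so the smallest factor can be
traded for exponents above `1` on the others (`prod_le_sum_prod_ite_rpow`). There is even room for
an exponent `s < 1` on the whole product; the unused power `1 - s` tends to zero off the diagonal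
(`tendsto_integral_prod_density_mul_kernel`). -/

instance : IsProbabilityMeasure (volume : Measure UnitAddCircle) :=
  ⟨UnitAddCircle.measure_univ⟩

/-- The quotient map from real vectors to the torus. -/
def toTorus (ι : Type*) (y : ι → ℝ) : ι → UnitAddCircle := fun i => (y i : UnitAddCircle)

theorem measurePreserving_coe_Ico :
    MeasurePreserving ((↑) : ℝ → UnitAddCircle)
      (volume.restrict (Set.Ico (-1 / 2 : ℝ) (1 / 2))) volume := by
  have h := UnitAddCircle.measurePreserving_mk (-1 / 2)
  rw [show (-1 / 2 + 1 : ℝ) = 1 / 2 by norm_num] at h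
  rwa [Measure.restrict_congr_set Ico_ae_eq_Ioc]

theorem measurePreserving_toTorus (ι : Type*) [Fintype ι] :
    MeasurePreserving (toTorus ι)
      (volume.restrict (Set.univ.pi fun _ : ι => Set.Ico (-1 / 2 : ℝ) (1 / 2))) volume := by
  rw [volume_pi, Measure.restrict_pi_pi]
  exact measurePreserving_pi _ _ fun _ => measurePreserving_coe_Ico

/-- The volume of an iterated product does not depend on the order of the factors. -/
theorem measurePreserving_swap (ι κ : Type*) [Fintype ι] [Fintype κ] {T : Type*}
    [MeasureSpace T] [IsProbabilityMeasure (volume : Measure T)] :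
    MeasurePreserving (fun (z : ι → κ → T) (j : κ) (i : ι) => z i j) volume volume := by
  have hm : Measurable (fun (z : ι → κ → T) (j : κ) (i : ι) => z i j) := by fun_prop
  refine ⟨hm, ?_⟩
  symm
  -- Boxes whose sides are themselves boxes generate the iterated product, and on them the claim is
  -- an exchange of two finite products.
  refine Measure.pi_eq_generateFrom (μ := fun _ : κ => (volume : Measure (ι → T)))
    (C := fun _ => Set.univ.pi '' Set.univ.pi fun _ : ι => {s : Set T | MeasurableSet s})
    (fun _ => generateFrom_pi) (fun _ => isPiSystem_pi) (fun _ => ?_) ?_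
  · refine ⟨fun _ => Set.univ, fun _ => ⟨fun _ => Set.univ, ?_, by simp⟩, ?_, ?_⟩
    · intro i _; exact MeasurableSet.univ
    · intro _; simp
    · simp [Set.iUnion_const]
  · intro s hs
    choose u hu hus using hs
    have hu' : ∀ j i, MeasurableSet (u j i) := fun j i => hu j i (Set.mem_univ i)
    have hset : (fun (z : ι → κ → T) (j : κ) (i : ι) => z i j) ⁻¹' Set.univ.pi s =
        Set.univ.pi fun i => Set.univ.pi fun j => u j i := by
      ext z
      simp only [Set.mem_preimage, Set.mem_univ_pi, ← hus]
      exact forall_comm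
    rw [Measure.map_apply hm, hset]
    · simp_rw [← hus, volume_pi_pi]
      exact Finset.prod_comm
    · refine MeasurableSet.univ_pi fun j => ?_
      rw [← hus]
      exact MeasurableSet.univ_pi (hu' j)

/-- The kernel and its bound factor over the `d` coordinates, whereas the sample space is indexed by
blocks first; this exchange makes `d`-dimensional integrals into `d`-th powers. -/
theorem integral_prod_swap (ι κ : Type*) [Fintype ι] [Fintype κ] {T : Type*}
    [MeasureSpace T] [IsProbabilityMeasure (volume : Measure T)] {𝕜 : Type*} [RCLike 𝕜]
    (g : (ι → T) → 𝕜) (hg : Measurable g) :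
    ∫ z : ι → κ → T, ∏ j, g (fun i => z i j) = (∫ y, g y) ^ Fintype.card κ := by
  have h := (measurePreserving_swap ι κ (T := T)).map_eq
  rw [← integral_fintype_prod_volume_eq_pow, ← h,
    integral_map (measurePreserving_swap ι κ (T := T)).aemeasurable]
  exact (Finset.measurable_prod _ fun j _ => by fun_prop).aestronglyMeasurable

theorem lintegral_fintype_prod_eq {ι : Type*} [Fintype ι] {X : Type*} [MeasureSpace X]
    [IsProbabilityMeasure (volume : Measure X)] (g : ι → X → ENNReal)
    (hg : ∀ i, Measurable (g i)) :
    ∫⁻ z : ι → X, ∏ i, g i (z i) = ∏ i, ∫⁻ y, g i y := by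
  have h := iIndepFun_pi (μ := fun _ : ι => (volume : Measure X)) (X := g)
    fun i => (hg i).aemeasurable
  rw [volume_pi, lintegral_prod_eq_prod_lintegral_of_indepFun _ _ h (fun i => by fun_prop)]
  refine Finset.prod_congr rfl fun i _ => ?_
  exact (measurePreserving_eval (fun _ : ι => (volume : Measure X)) i).lintegral_comp (hg i)

/-! ### The Dirichlet-type kernel on the circle -/

/-- The kernel `∑_{ℓ < n} e(ℓ t)` on the circle. -/
def dirichlet (n : ℕ) (t : UnitAddCircle) : ℂ := ∑ ℓ ∈ Finset.range n, fourier (ℓ : ℤ) t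

theorem continuous_dirichlet (n : ℕ) : Continuous (dirichlet n) := by
  unfold dirichlet; fun_prop

theorem expSum_eq_dirichlet (n : ℕ) (t : ℝ) : expSum n t = dirichlet n (t : UnitAddCircle) := by
  refine Finset.sum_congr rfl fun ℓ _ => ?_
  rw [fourier_coe_apply]
  congr 1
  push_cast
  ring

theorem norm_fourier_apply (m : ℤ) (t : UnitAddCircle) : ‖fourier m t‖ = 1 := by
  rw [fourier_apply]; exact Circle.norm_coe _

theorem norm_dirichlet_le_card (n : ℕ) (t : UnitAddCircle) : ‖dirichlet n t‖ ≤ n := by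
  refine (norm_sum_le _ _).trans ?_
  simp only [norm_fourier_apply]
  simp

/-- With a representative `|s| ≤ 1 / 2`, the chord has length `2 |sin (π s)|`, and Jordan's
inequality bounds it below by `4 |s|`. -/
theorem four_mul_norm_le (t : UnitAddCircle) : 4 * ‖t‖ ≤ ‖fourier 1 t - (1 : ℂ)‖ := by
  obtain ⟨s, hs, rfl⟩ : ∃ s : ℝ, |s| ≤ 1 / 2 ∧ (s : UnitAddCircle) = t := by
    obtain ⟨s, hs, rfl⟩ := (AddCircle.coe_image_Icc_eq (1 : ℝ) (-1 / 2)).ge (Set.mem_univ t)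
    exact ⟨s, abs_le.2 ⟨by linarith [hs.1], by linarith [hs.2]⟩, rfl⟩
  have h1 : ‖(s : UnitAddCircle)‖ = |s| := by
    rw [AddCircle.norm_coe_eq_abs_iff _ one_ne_zero]; simpa using hs
  have h2 : ‖fourier 1 (s : UnitAddCircle) - (1 : ℂ)‖ = ‖2 * Real.sin (Real.pi * s)‖ := by
    rw [fourier_coe_apply, show (2 * Real.pi * Complex.I * (1 : ℤ) * s / (1 : ℝ) : ℂ) =
      Complex.I * ((2 * Real.pi * s : ℝ) : ℂ) by push_cast; ring,
      Complex.norm_exp_I_mul_ofReal_sub_one]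
    congr 3; ring
  rw [h1, h2]
  have h3 : |Real.pi * s| ≤ Real.pi / 2 := by
    rw [abs_mul, abs_of_pos Real.pi_pos]; nlinarith [Real.pi_pos]
  have h4 := Real.mul_abs_le_abs_sin h3
  rw [abs_mul, abs_of_pos Real.pi_pos] at h4
  have h5 : 2 / Real.pi * (Real.pi * |s|) = 2 * |s| := by
    field_simp
  rw [norm_mul, Real.norm_eq_abs, Real.norm_eq_abs]
  norm_num
  linarith

/-- The geometric sum times `e(t) - 1` telescopes to a difference of two unit complex numbers. -/
theorem norm_dirichlet_mul_norm_le (n : ℕ) (t : UnitAddCircle) :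
    ‖dirichlet n t‖ * ‖t‖ ≤ 1 / 2 := by
  have h : dirichlet n t * (fourier 1 t - 1) = fourier 1 t ^ n - 1 := by
    rw [← geom_sum_mul]
    congr 1
    refine Finset.sum_congr rfl fun ℓ _ => ?_
    rw [fourier_one, fourier_apply, natCast_zsmul, AddCircle.toCircle_nsmul, Circle.coe_pow]
  have h2 : ‖fourier 1 t ^ n - (1 : ℂ)‖ ≤ 2 := by
    refine (norm_sub_le _ _).trans ?_
    rw [norm_pow, norm_fourier_apply]
    norm_num
  have h3 := mul_le_mul_of_nonneg_left (four_mul_norm_le t) (norm_nonneg (dirichlet n t))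
  rw [← norm_mul, h] at h3
  linarith

/-- The decay profile `1 / (1 + n ‖t‖)` dominating the normalized kernel. -/
def decay (n : ℕ) (t : UnitAddCircle) : ℝ := (1 + n * ‖t‖)⁻¹

theorem decay_pos (n : ℕ) (t : UnitAddCircle) : 0 < decay n t := by
  unfold decay; positivity

theorem decay_le_one (n : ℕ) (t : UnitAddCircle) : decay n t ≤ 1 :=
  inv_le_one_of_one_le₀ (by have : 0 ≤ n * ‖t‖ := by positivity
                            linarith)

theorem continuous_decay (n : ℕ) : Continuous (decay n) := by
  unfold decay
  refine Continuous.inv₀ (by fun_prop) fun t => ?_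
  positivity

theorem norm_dirichlet_le (n : ℕ) (t : UnitAddCircle) :
    ‖dirichlet n t‖ ≤ 2 * n * decay n t := by
  unfold decay
  rw [← div_eq_mul_inv, le_div_iff₀ (by positivity)]
  have h1 := norm_dirichlet_le_card n t
  have h2 := norm_dirichlet_mul_norm_le n t
  have hn : (0 : ℝ) ≤ n := n.cast_nonneg
  nlinarith

/-- Powers of the decay profile with exponent above `1` have mass of order `1 / n`. -/
theorem exists_lintegral_decay_rpow_le {a : ℝ} (ha : 1 < a) :
    ∃ C : NNReal, ∀ n : ℕ, 0 < n →
      ∫⁻ t : UnitAddCircle, ENNReal.ofReal (decay n t ^ a) ≤ C / n := by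
  have hint : Integrable (fun s : ℝ => (1 + ‖s‖) ^ (-a)) :=
    integrable_one_add_norm (by simpa using ha)
  have hfin : ∫⁻ s : ℝ, ENNReal.ofReal ((1 + ‖s‖) ^ (-a)) ≠ ⊤ := by
    have := hint.hasFiniteIntegral
    rw [hasFiniteIntegral_iff_ofReal (ae_of_all _ fun s => by positivity)] at this
    exact this.ne
  refine ⟨(∫⁻ s : ℝ, ENNReal.ofReal ((1 + ‖s‖) ^ (-a))).toNNReal, fun n hn => ?_⟩
  rw [ENNReal.coe_toNNReal hfin]
  have hn' : (0 : ℝ) < n := by exact_mod_cast hn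
  rw [← UnitAddCircle.lintegral_preimage (-1 / 2)]
  -- Rescaling by `n` produces the factor `1 / n`; the integral over the whole line is finite
  -- because `a > 1`.
  have hscale : ∫⁻ s : ℝ, ENNReal.ofReal ((1 + ‖(n : ℝ) * s‖) ^ (-a)) =
      (∫⁻ s : ℝ, ENNReal.ofReal ((1 + ‖s‖) ^ (-a))) / n := by
    have := lintegral_map (μ := (volume : Measure ℝ))
      (f := fun s : ℝ => ENNReal.ofReal ((1 + ‖s‖) ^ (-a))) (g := fun s : ℝ => (n : ℝ) * s)
      (by fun_prop) (by fun_prop)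
    rw [← this, Real.map_volume_mul_left hn'.ne', lintegral_smul_measure,
      abs_of_pos (by positivity), ENNReal.ofReal_inv_of_pos hn', ENNReal.ofReal_natCast,
      smul_eq_mul, div_eq_mul_inv, mul_comm]
  rw [← hscale]
  refine (setLIntegral_mono' measurableSet_Ioc fun s hs => ?_).trans
    (setLIntegral_le_lintegral (Set.Ioc (-1 / 2 : ℝ) (-1 / 2 + 1)) _)
  refine ENNReal.ofReal_le_ofReal (le_of_eq ?_)
  have h1 : ‖(s : UnitAddCircle)‖ = |s| := by
    rw [AddCircle.norm_coe_eq_abs_iff _ one_ne_zero]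
    rw [abs_one]
    exact abs_le.2 ⟨by linarith [hs.1], by linarith [hs.2]⟩
  rw [decay, h1, Real.inv_rpow (by positivity), Real.rpow_neg (by positivity), norm_mul,
    Real.norm_eq_abs, Real.norm_eq_abs, Nat.abs_cast]

/-! ### Integrals of products of decay profiles along closed walks -/

section Walk

/-- Induction along the walk. A step to a new vertex introduces a variable occurring in that factor
alone, and integrating it out gives `∫ h` by invariance; a step to a visited vertex is discarded
since `h ≤ 1`. The starting vertex yields no factor, hence the `- 1`. -/
theorem lmarginal_walk_le {ι : Type*} [DecidableEq ι] (h : UnitAddCircle → ENNReal)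
    (hm : Measurable h) (h1 : ∀ t, h t ≤ 1) (w : ℕ → ι) (N : ℕ) (x : ι → UnitAddCircle) :
    (∫⋯∫⁻_(Finset.range (N + 1)).image w,
      (fun y => ∏ j ∈ Finset.range N, h (y (w j) - y (w (j + 1)))) ∂fun _ => volume) x ≤
      (∫⁻ t, h t) ^ (((Finset.range (N + 1)).image w).card - 1) := by
  induction N generalizing x with
  | zero =>
    simp [lmarginal_singleton]
  | succ N ih =>
    have hmeas : ∀ M, Measurable fun y : ι → UnitAddCircle =>
        ∏ j ∈ Finset.range M, h (y (w j) - y (w (j + 1))) := fun M => by fun_prop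
    by_cases hw : w (N + 1) ∈ (Finset.range (N + 1)).image w
    · have himg : (Finset.range (N + 1 + 1)).image w = (Finset.range (N + 1)).image w := by
        rw [Finset.range_add_one (n := N + 1), Finset.image_insert, Finset.insert_eq_of_mem hw]
      rw [himg]
      refine le_trans (lmarginal_mono (fun y => ?_) x) (ih x)
      rw [Finset.prod_range_succ]
      exact mul_le_of_le_one_right' (h1 _)
    · have himg : (Finset.range (N + 1 + 1)).image w =
          insert (w (N + 1)) ((Finset.range (N + 1)).image w) := by
        rw [Finset.range_add_one (n := N + 1), Finset.image_insert]
      rw [himg, lmarginal_insert' _ (hmeas _) hw, Finset.card_insert_of_notMem hw]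
      have hne : ∀ j ≤ N, w j ≠ w (N + 1) := fun j hj hj' =>
        hw (hj' ▸ Finset.mem_image_of_mem w (Finset.mem_range.2 (by omega)))
      have hinner : ∀ y : ι → UnitAddCircle,
          (∫⁻ t, ∏ j ∈ Finset.range (N + 1),
            h (Function.update y (w (N + 1)) t (w j) -
              Function.update y (w (N + 1)) t (w (j + 1)))) =
            (∏ j ∈ Finset.range N, h (y (w j) - y (w (j + 1)))) * ∫⁻ t, h t := by
        intro y
        have : ∀ t, (∏ j ∈ Finset.range (N + 1),
            h (Function.update y (w (N + 1)) t (w j) -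
              Function.update y (w (N + 1)) t (w (j + 1)))) =
            (∏ j ∈ Finset.range N, h (y (w j) - y (w (j + 1)))) * h (y (w N) - t) := by
          intro t
          rw [Finset.prod_range_succ, Function.update_self,
            Function.update_of_ne (hne N le_rfl)]
          congr 1
          refine Finset.prod_congr rfl fun j hj => ?_
          have := Finset.mem_range.1 hj
          rw [Function.update_of_ne (hne j (by omega)),
            Function.update_of_ne (hne (j + 1) (by omega))]
        simp_rw [this]
        rw [lintegral_const_mul _ (by fun_prop), lintegral_sub_left_eq_self]
      simp_rw [hinner]
      have hcard : ((Finset.range (N + 1)).image w).card - 1 + 1 =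
          ((Finset.range (N + 1)).image w).card :=
        Nat.sub_add_cancel (Finset.card_pos.2 (by simp))
      rw [Nat.add_sub_cancel, ← hcard, pow_succ]
      have hmul : (∫⋯∫⁻_(Finset.range (N + 1)).image w,
          (fun y => (∏ j ∈ Finset.range N, h (y (w j) - y (w (j + 1)))) * ∫⁻ t, h t)
            ∂fun _ => volume) x =
          (∫⋯∫⁻_(Finset.range (N + 1)).image w,
          (fun y => (∏ j ∈ Finset.range N, h (y (w j) - y (w (j + 1)))))
            ∂fun _ => volume) x * ∫⁻ t, h t := by
        unfold lmarginal
        rw [lintegral_mul_const]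
        exact (hmeas N).comp (measurable_updateFinset)
      rw [hmul]
      exact mul_le_mul_left (ih x) _

variable {ι : Type*} [Fintype ι]

theorem lintegral_walk_le (h : UnitAddCircle → ENNReal) (hm : Measurable h)
    (h1 : ∀ t, h t ≤ 1) (w : ℕ → ι) (N : ℕ) (hw : ∀ B, ∃ j ≤ N, w j = B) :
    ∫⁻ y : ι → UnitAddCircle, ∏ j ∈ Finset.range N, h (y (w j) - y (w (j + 1))) ≤
      (∫⁻ t, h t) ^ (Fintype.card ι - 1) := by
  classical
  have himg : (Finset.range (N + 1)).image w = Finset.univ := by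
    refine Finset.eq_univ_of_forall fun B => ?_
    obtain ⟨j, hj, rfl⟩ := hw B
    exact Finset.mem_image_of_mem w (Finset.mem_range.2 (by omega))
  have := lmarginal_walk_le h hm h1 w N (fun _ => 0)
  rwa [himg, Finset.card_univ, ← lintegral_eq_lmarginal_univ] at this

/-- Cutting the cycle at step `i` gives a linear walk that starts at `i + 1`; the omitted step comes
last in this order. -/
theorem prod_ite_eq_prod_range {M : Type*} [CommMonoid M] {N : ℕ} (f : Fin (N + 1) → M)
    (i : Fin (N + 1)) :
    ∏ j, (if j = i then 1 else f j) = ∏ m ∈ Finset.range N, f (i + 1 + Fin.ofNat (N + 1) m) := by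
  have hlast : i + 1 + Fin.last N = i := by
    rw [add_assoc, add_comm 1, Fin.last_add_one, add_zero]
  rw [← Equiv.prod_comp (Equiv.addLeft (i + 1)), Fin.prod_univ_castSucc, Finset.prod_range]
  simp only [Equiv.coe_addLeft, hlast, if_true, mul_one]
  refine Finset.prod_congr rfl fun m _ => ?_
  have hne : i + 1 + m.castSucc ≠ i := fun h =>
    (Fin.castSucc_lt_last m).ne (add_left_cancel (h.trans hlast.symm))
  refine (if_neg hne).trans ?_
  congr 2
  ext
  simp

/-- Removing one step from a closed walk through all vertices leaves a walk through all vertices. -/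
theorem lintegral_closed_walk_le {N : ℕ} (b : Fin (N + 1) → ι) (hb : Function.Surjective b)
    (h : UnitAddCircle → ENNReal) (hm : Measurable h) (h1 : ∀ t, h t ≤ 1) (i : Fin (N + 1)) :
    ∫⁻ y : ι → UnitAddCircle, ∏ j, (if j = i then 1 else h (y (b j) - y (b (j + 1)))) ≤
      (∫⁻ t, h t) ^ (Fintype.card ι - 1) := by
  simp_rw [prod_ite_eq_prod_range]
  refine le_trans (le_of_eq ?_) (lintegral_walk_le h hm h1
    (fun m => b (i + 1 + Fin.ofNat (N + 1) m)) N ?_)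
  · have : ∀ m, Fin.ofNat (N + 1) (m + 1) = Fin.ofNat (N + 1) m + 1 := fun m => by
      ext; simp [Fin.val_add]
    simp only [this, add_assoc]
  · intro B
    obtain ⟨j, rfl⟩ := hb B
    refine ⟨(j - (i + 1) : Fin (N + 1)), Nat.le_of_lt_succ (Fin.is_lt _), ?_⟩
    simp

/-- Write the smallest factor as a product of `N + 1` copies of its `(N + 1)`-th root and bound each
root by that of another factor, or by `1`. The summation over `i` covers every possible position of
the minimum. -/
theorem prod_le_sum_prod_ite_rpow {N : ℕ} (g : Fin (N + 1) → ℝ) (h0 : ∀ i, 0 ≤ g i)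
    (h1 : ∀ i, g i ≤ 1) :
    ∏ i, g i ≤ ∑ i, ∏ j, (if j = i then 1 else g j ^ (1 + 1 / (N + 1 : ℝ))) := by
  obtain ⟨i, -, hi⟩ := Finset.exists_min_image Finset.univ g Finset.univ_nonempty
  refine le_trans ?_ (Finset.single_le_sum (f := fun i => ∏ j,
    (if j = i then (1 : ℝ) else g j ^ (1 + 1 / (N + 1 : ℝ)))) (fun i _ => ?_) (Finset.mem_univ i))
  · have hN : (0 : ℝ) < N + 1 := by positivity
    have hsplit : ∀ j, (if j = i then (1 : ℝ) else g j ^ (1 + 1 / (N + 1 : ℝ))) =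
        (if j = i then (1 : ℝ) else g j) * (if j = i then 1 else g j ^ (1 / (N + 1 : ℝ))) := by
      intro j
      split_ifs
      · simp
      · rw [Real.rpow_add_of_nonneg (h0 j) zero_le_one (by positivity), Real.rpow_one]
    have hprod : ∏ j, g j = (∏ j, if j = i then (1 : ℝ) else g j) * g i := by
      have : ∀ j, g j = (if j = i then (1 : ℝ) else g j) * (if j = i then g i else 1) := by
        intro j; split_ifs with h <;> simp [h]
      rw [Finset.prod_congr rfl fun j _ => this j, Finset.prod_mul_distrib]
      simp
    simp only [hsplit]
    rw [hprod, Finset.prod_mul_distrib]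
    refine mul_le_mul_of_nonneg_left ?_ (Finset.prod_nonneg fun j _ => ?_)
    · calc g i = ∏ _j : Fin (N + 1), g i ^ (1 / (N + 1 : ℝ)) := by
            rw [Finset.prod_const, Finset.card_univ, Fintype.card_fin, ← Real.rpow_natCast,
              ← Real.rpow_mul (h0 i)]
            push_cast
            rw [one_div_mul_cancel hN.ne', Real.rpow_one]
        _ ≤ _ := by
            refine Finset.prod_le_prod (fun j _ => Real.rpow_nonneg (h0 i) _) fun j _ => ?_
            split_ifs
            · exact Real.rpow_le_one (h0 i) (h1 i) (by positivity)
            · exact Real.rpow_le_rpow (h0 i) (hi j (Finset.mem_univ j)) (by positivity)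
    · split_ifs
      · exact zero_le_one
      · exact h0 j
  · refine Finset.prod_nonneg fun j _ => ?_
    split_ifs
    · exact zero_le_one
    · exact Real.rpow_nonneg (h0 j) _

/-- The product of decay profiles along a closed walk stays integrable at the critical scale
even after lowering the exponent a little. -/
theorem exists_lintegral_prod_decay_rpow_le {N : ℕ} (b : Fin (N + 1) → ι)
    (hb : Function.Surjective b) :
    ∃ s : ℝ, 0 < s ∧ s < 1 ∧ ∃ C : NNReal, ∀ n : ℕ, 0 < n →
      ∫⁻ y : ι → UnitAddCircle, ENNReal.ofReal ((∏ i, decay n (y (b i) - y (b (i + 1)))) ^ s) ≤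
        C / (n : ENNReal) ^ (Fintype.card ι - 1) := by
  have hN : (0 : ℝ) ≤ N := N.cast_nonneg
  -- The exponent `s` must be below `1` while `s * (N + 2) / (N + 1)` exceeds `1`, that is, it must
  -- lie strictly between `(N + 1) / (N + 2)` and `1`; this is the midpoint.
  have hs0 : (0 : ℝ) < (N + 3 / 2) / (N + 2) := by positivity
  have ha : (1 : ℝ) < (N + 3 / 2) / (N + 2) * (1 + 1 / (N + 1)) := by
    have : ((N : ℝ) + 3 / 2) / (N + 2) * (1 + 1 / (N + 1)) = (N + 3 / 2) / (N + 1) := by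
      field_simp; ring
    rw [this, one_lt_div (by positivity)]
    linarith
  obtain ⟨C, hC⟩ := exists_lintegral_decay_rpow_le ha
  refine ⟨(N + 3 / 2) / (N + 2), hs0, ?_, (N + 1) * C ^ (Fintype.card ι - 1), fun n hn => ?_⟩
  · rw [div_lt_one (by positivity)]; linarith
  set s : ℝ := (N + 3 / 2) / (N + 2)
  set a : ℝ := s * (1 + 1 / (N + 1))
  set h : UnitAddCircle → ENNReal := fun t => ENNReal.ofReal (decay n t ^ a) with hh
  have hm : Measurable h := by
    have := (continuous_decay n).measurable
    fun_prop
  have h1 : ∀ t, h t ≤ 1 := fun t => ENNReal.ofReal_le_one.2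
    (Real.rpow_le_one (decay_pos n t).le (decay_le_one n t) (by linarith))
  have hpt : ∀ y : ι → UnitAddCircle,
      ENNReal.ofReal ((∏ i, decay n (y (b i) - y (b (i + 1)))) ^ s) ≤
        ∑ i, ∏ j, (if j = i then 1 else h (y (b j) - y (b (j + 1)))) := by
    intro y
    have hd0 := fun i => (decay_pos n (y (b i) - y (b (i + 1)))).le
    rw [← Real.finsetProd_rpow _ _ fun i _ => hd0 i]
    refine (ENNReal.ofReal_le_ofReal (prod_le_sum_prod_ite_rpow _
      (fun i => Real.rpow_nonneg (hd0 i) _)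
      (fun i => Real.rpow_le_one (hd0 i) (decay_le_one _ _) hs0.le))).trans (le_of_eq ?_)
    have hnn : ∀ i j : Fin (N + 1), (0 : ℝ) ≤ if j = i then (1 : ℝ) else
        (decay n (y (b j) - y (b (j + 1))) ^ s) ^ (1 + 1 / (N + 1 : ℝ)) := by
      intro i j
      split_ifs
      · exact zero_le_one
      · exact Real.rpow_nonneg (Real.rpow_nonneg (hd0 j) _) _
    rw [ENNReal.ofReal_sum_of_nonneg fun i _ => Finset.prod_nonneg fun j _ => hnn i j]
    refine Finset.sum_congr rfl fun i _ => ?_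
    rw [ENNReal.ofReal_prod_of_nonneg fun j _ => hnn i j]
    refine Finset.prod_congr rfl fun j _ => ?_
    split_ifs
    · exact ENNReal.ofReal_one
    · rw [hh, ← Real.rpow_mul (hd0 j)]
  calc _ ≤ ∫⁻ y : ι → UnitAddCircle, ∑ i : Fin (N + 1), ∏ j,
        (if j = i then 1 else h (y (b j) - y (b (j + 1)))) := lintegral_mono hpt
    _ = ∑ i : Fin (N + 1), ∫⁻ y : ι → UnitAddCircle, ∏ j,
        (if j = i then 1 else h (y (b j) - y (b (j + 1)))) := by
      refine lintegral_finsetSum _ fun i _ => Finset.measurable_prod _ fun j _ => ?_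
      split_ifs
      · exact measurable_const
      · fun_prop
    _ ≤ ∑ _i : Fin (N + 1), (C / (n : ENNReal)) ^ (Fintype.card ι - 1) := by
      refine Finset.sum_le_sum fun i _ => (lintegral_closed_walk_le b hb h hm h1 i).trans ?_
      exact pow_le_pow_left' (hC n hn) _
    _ = _ := by
      rw [Finset.sum_const, Finset.card_univ, Fintype.card_fin, nsmul_eq_mul]
      push_cast
      rw [div_eq_mul_inv, mul_pow, ← ENNReal.inv_pow, ← mul_assoc, div_eq_mul_inv]

end Walk

/-! ### Lattice points of kernels of integer maps in dilated cubes -/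

open scoped Pointwise in
-- In coordinates for a basis of the kernel, the points counted are exactly the integer points of `n
-- • s` for a fixed convex set `s`, so the limit is the volume of `s`. Half-open constraints make
-- the correspondence exact for every positive `n`.
theorem exists_tendsto_card_ker_div_pow {α β : Type*} [Fintype α] [Fintype β]
    (A : (α → ℤ) →ₗ[ℤ] (β → ℤ)) :
    ∃ v : ℝ, Tendsto (fun n : ℕ =>
      (Nat.card {ℓ : α → ℤ | A ℓ = 0 ∧ ∀ a, 0 ≤ ℓ a ∧ ℓ a < n} : ℝ) /
        (n : ℝ) ^ Module.finrank ℤ (LinearMap.ker A)) atTop (𝓝 v) := by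
  classical
  set r := Module.finrank ℤ (LinearMap.ker A)
  let e : Module.Basis (Fin r) ℤ (LinearMap.ker A) := Module.finBasis ℤ _
  -- The range is a submodule of a free `ℤ`-module of finite rank, hence projective, so the kernel
  -- splits off. The projection `π` then gives integer coefficients `c` that recover the basis
  -- coordinates from the ambient ones, which yields boundedness of `s`.
  obtain ⟨σ, hσ⟩ := A.rangeRestrict.exists_rightInverse_of_surjective A.range_rangeRestrict
  have hπ : ∀ x, x - σ (A.rangeRestrict x) ∈ LinearMap.ker A := fun x => by
    have h1 : A.rangeRestrict (σ (A.rangeRestrict x)) = A.rangeRestrict x :=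
      LinearMap.congr_fun hσ _
    have h2 := congrArg Subtype.val h1
    change A (σ (A.rangeRestrict x)) = A x at h2
    rw [LinearMap.mem_ker, map_sub, h2, sub_self]
  let π : (α → ℤ) →ₗ[ℤ] LinearMap.ker A :=
    (LinearMap.id - σ ∘ₗ A.rangeRestrict).codRestrict _ hπ
  have hπ' : ∀ x : LinearMap.ker A, π x = x := fun x => by
    have h0 : A.rangeRestrict (x : α → ℤ) = 0 := by
      ext1; exact x.2
    ext1
    simp [π, h0]
  let c : Fin r → α → ℤ := fun i a => e.repr (π (Pi.single a 1)) i
  have hc : ∀ i j, ∑ a, (e j : α → ℤ) a * c i a = if j = i then 1 else 0 := by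
    intro i j
    have h1 : (e j : α → ℤ) = ∑ a, (e j : α → ℤ) a • Pi.single a (1 : ℤ) := by
      ext a; simp [Finset.sum_apply, Pi.single_apply]
    have h2 := congrArg (fun x => e.repr (π x) i) h1
    simp only [hπ', map_sum, map_smul, Module.Basis.repr_self, Finsupp.single_apply,
      Finsupp.finsetSum_apply, Finsupp.smul_apply, smul_eq_mul] at h2
    exact h2.symm
  let s : Set (Fin r → ℝ) := {x | ∀ a, ∑ j, x j * ((e j : α → ℤ) a : ℝ) ∈ Set.Ico (0 : ℝ) 1}
  have hrec : ∀ (x : Fin r → ℝ) i,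
      x i = ∑ a, (∑ j, x j * ((e j : α → ℤ) a : ℝ)) * (c i a : ℝ) := by
    intro x i
    simp_rw [Finset.sum_mul]
    rw [Finset.sum_comm]
    have : ∀ j, ∑ a, x j * ((e j : α → ℤ) a : ℝ) * (c i a : ℝ) =
        x j * ((∑ a, (e j : α → ℤ) a * c i a : ℤ) : ℝ) := by
      intro j; push_cast; rw [Finset.mul_sum]; simp_rw [mul_assoc]
    simp_rw [this, hc]
    simp
  have hs1 : Bornology.IsBounded s := by
    refine (isBounded_iff_forall_norm_le).2 ⟨∑ i, ∑ a, |(c i a : ℝ)|, fun x hx => ?_⟩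
    refine (pi_norm_le_iff_of_nonneg (by positivity)).2 fun i => ?_
    rw [hrec x i]
    refine (norm_sum_le _ _).trans ?_
    refine le_trans (Finset.sum_le_sum fun a _ => ?_)
      (Finset.single_le_sum (f := fun i => ∑ a, |(c i a : ℝ)|) (fun i _ => by positivity)
        (Finset.mem_univ i))
    rw [norm_mul, Real.norm_eq_abs, Real.norm_eq_abs]
    refine mul_le_of_le_one_left (abs_nonneg _) ?_
    rw [abs_of_nonneg (hx a).1]
    exact (hx a).2.le
  have hs2 : MeasurableSet s := by
    simp only [s, Set.ofPred_forall]
    refine MeasurableSet.iInter fun a => ?_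
    exact measurableSet_Ico.preimage (by fun_prop)
  have hs3 : Convex ℝ s := by
    simp only [s, Set.ofPred_forall]
    refine convex_iInter fun a => ?_
    refine (convex_Ico (0 : ℝ) 1).is_linear_preimage
      (f := fun x : Fin r → ℝ => ∑ j, x j * ((e j : α → ℤ) a : ℝ)) ⟨?_, ?_⟩
    · intro x y; simp [add_mul, Finset.sum_add_distrib]
    · intro t x; simp [Finset.mul_sum, mul_assoc]
  -- Convexity is used only to make the frontier of `s` null.
  have key := tendsto_card_div_pow_atTop_volume s hs1 hs2 (hs3.addHaar_frontier volume)
  refine ⟨_, key.congr' ?_⟩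
  filter_upwards [eventually_gt_atTop 0] with n hn
  have hn' : (0 : ℝ) < n := by exact_mod_cast hn
  have : NeZero n := ⟨hn.ne'⟩
  rw [Fintype.card_fin]
  congr 2
  let D : Set (Fin r → ℤ) := {x | ∀ a, 0 ≤ ∑ j, x j * (e j : α → ℤ) a ∧
    ∑ j, x j * (e j : α → ℤ) a < n}
  have hcoe : ∀ x : Fin r → ℤ, ((∑ j, x j • e j : LinearMap.ker A) : α → ℤ) =
      fun a => ∑ j, x j * (e j : α → ℤ) a := by
    intro x; ext a; simp [Finset.sum_apply]
  have h1 : {ℓ : α → ℤ | A ℓ = 0 ∧ ∀ a, 0 ≤ ℓ a ∧ ℓ a < n} =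
      (fun (x : Fin r → ℤ) (a : α) => ∑ j, x j * (e j : α → ℤ) a) '' D := by
    ext ℓ
    constructor
    · rintro ⟨hA, hℓ⟩
      have hrepr := congrArg Subtype.val (e.sum_repr ⟨ℓ, hA⟩)
      rw [hcoe] at hrepr
      refine ⟨fun j => e.repr ⟨ℓ, hA⟩ j, fun a => ?_, hrepr⟩
      have := congrFun hrepr a
      simp only at this
      rw [this]
      exact hℓ a
    · rintro ⟨x, hx, rfl⟩
      refine ⟨?_, hx⟩
      change A (fun a => ∑ j, x j * (e j : α → ℤ) a) = 0
      rw [← hcoe x]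
      exact (∑ j, x j • e j : LinearMap.ker A).2
  have h2 : s ∩ (n : ℝ)⁻¹ • (Submodule.span ℤ (Set.range (Pi.basisFun ℝ (Fin r))) :
      Set (Fin r → ℝ)) = (fun (x : Fin r → ℤ) (j : Fin r) => (x j : ℝ) / n) '' D := by
    have hval : ∀ (x : Fin r → ℤ) a, ∑ j, ((x j : ℝ) / n) * ((e j : α → ℤ) a : ℝ) =
        ((∑ j, x j * (e j : α → ℤ) a : ℤ) : ℝ) / n := by
      intro x a; push_cast; rw [Finset.sum_div]
      exact Finset.sum_congr rfl fun j _ => by ring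
    have hiff : ∀ x : Fin r → ℤ, (fun j => (x j : ℝ) / n) ∈ s ↔ x ∈ D := by
      intro x
      refine forall_congr' fun a => ?_
      rw [hval, Set.mem_Ico, le_div_iff₀ hn', zero_mul, div_lt_one hn']
      norm_cast
    ext v
    constructor
    · rintro ⟨hvs, hv⟩
      have hv' := BoxIntegral.unitPartition.mem_smul_span_iff.1 hv
      choose x hx using hv'
      have hvx : v = fun j => (x j : ℝ) / n := by
        ext j
        have := hx j
        rw [eq_intCast] at this
        rw [this]; field_simp
      subst hvx
      exact ⟨x, (hiff x).1 hvs, rfl⟩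
    · rintro ⟨x, hx, rfl⟩
      refine ⟨(hiff x).2 hx, BoxIntegral.unitPartition.mem_smul_span_iff.2 fun j => ⟨x j, ?_⟩⟩
      rw [eq_intCast]; field_simp
  rw [h2, h1, Nat.card_image_of_injective, Nat.card_image_of_injective]
  · intro x y hxy
    have h3 : (∑ j, x j • e j : LinearMap.ker A) = ∑ j, y j • e j := by
      ext1; rw [hcoe, hcoe]; exact hxy
    ext j
    have h4 := congrArg (fun z => e.repr z j) h3
    simpa [Finsupp.single_apply] using h4
  · intro x y hxy
    ext j
    have := congrFun hxy j
    simp only at this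
    rw [div_left_inj' hn'.ne'] at this
    exact_mod_cast this

/-! ### Closed walks and circulations -/

section Boundary

variable {ι : Type*} {N : ℕ}

/-- The boundary of an integer chain on the steps of the closed walk `b`. -/
def boundary [DecidableEq ι] (b : Fin (N + 1) → ι) : (Fin (N + 1) → ℤ) →ₗ[ℤ] (ι → ℤ) :=
  ∑ i, (LinearMap.proj i : (Fin (N + 1) → ℤ) →ₗ[ℤ] ℤ).smulRight
    (Pi.single (b i) 1 - Pi.single (b (i + 1)) 1)

theorem boundary_apply [DecidableEq ι] (b : Fin (N + 1) → ι) (ℓ : Fin (N + 1) → ℤ) :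
    boundary b ℓ = ∑ i, ℓ i • (Pi.single (b i) 1 - Pi.single (b (i + 1)) 1 : ι → ℤ) := by
  simp [boundary]

variable [Fintype ι]

/-- The walk joins `b 0` to every vertex, so telescoping its steps gives each difference `δ_{b 0} -
δ_B`, and these span the vectors of coordinate sum zero. -/
theorem range_boundary [DecidableEq ι] (b : Fin (N + 1) → ι) (hb : Function.Surjective b) :
    LinearMap.range (boundary b) =
      LinearMap.ker (∑ B, LinearMap.proj B : (ι → ℤ) →ₗ[ℤ] ℤ) := by
  apply le_antisymm
  · rintro _ ⟨ℓ, rfl⟩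
    rw [boundary_apply, LinearMap.mem_ker, map_sum]
    refine Finset.sum_eq_zero fun i _ => ?_
    rw [map_smul]
    simp [LinearMap.sum_apply, Finset.sum_sub_distrib]
  · have hstep : ∀ i, (Pi.single (b i) 1 - Pi.single (b (i + 1)) 1 : ι → ℤ) ∈
        LinearMap.range (boundary b) := fun i => by
      refine ⟨Pi.single i 1, ?_⟩
      rw [boundary_apply, Finset.sum_eq_single i] <;> simp +contextual
    have hpath : ∀ i, (Pi.single (b 0) 1 - Pi.single (b i) 1 : ι → ℤ) ∈
        LinearMap.range (boundary b) := by
      intro i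
      induction i using Fin.induction with
      | zero => simp
      | succ i ih =>
        have := Submodule.add_mem _ ih (hstep i.castSucc)
        rwa [sub_add_sub_cancel, Fin.coeSucc_eq_succ] at this
    intro c hc
    have hc0 : ∑ B, c B = 0 := by simpa [LinearMap.sum_apply] using hc
    have : c = -∑ B, c B • (Pi.single (b 0) 1 - Pi.single B 1 : ι → ℤ) := by
      simp_rw [smul_sub]
      rw [Finset.sum_sub_distrib, ← Finset.sum_smul, hc0, zero_smul, zero_sub, neg_neg]
      ext B; simp [Finset.sum_apply, Pi.single_apply]
    rw [this]
    refine Submodule.neg_mem _ (Submodule.sum_mem _ fun B _ => Submodule.smul_mem _ _ ?_)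
    obtain ⟨i, rfl⟩ := hb B
    exact hpath i

theorem finrank_range_add_finrank_ker_int {M M' : Type*} [AddCommGroup M] [AddCommGroup M']
    [Module.Finite ℤ M] (f : M →ₗ[ℤ] M') :
    Module.finrank ℤ (LinearMap.range f) + Module.finrank ℤ (LinearMap.ker f) =
      Module.finrank ℤ M := by
  rw [← f.quotKerEquivRange.finrank_eq, Submodule.finrank_quotient_add_finrank]

/-- First Betti number of a connected graph: edges minus vertices plus one. The truncated
subtraction is harmless because surjectivity of `b` bounds the number of vertices. -/
theorem finrank_ker_boundary [DecidableEq ι] (b : Fin (N + 1) → ι)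
    (hb : Function.Surjective b) :
    Module.finrank ℤ (LinearMap.ker (boundary b)) = N + 1 - Fintype.card ι + 1 := by
  have h1 := finrank_range_add_finrank_ker_int (boundary b)
  have h2 := finrank_range_add_finrank_ker_int (∑ B, LinearMap.proj B : (ι → ℤ) →ₗ[ℤ] ℤ)
  have h3 : LinearMap.range (∑ B, LinearMap.proj B : (ι → ℤ) →ₗ[ℤ] ℤ) = ⊤ := by
    refine LinearMap.range_eq_top.2 fun m => ⟨Pi.single (b 0) m, ?_⟩
    simp [LinearMap.sum_apply]
  rw [range_boundary b hb] at h1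
  rw [h3, finrank_top] at h2
  have h4 := Fintype.card_le_of_surjective b hb
  simp only [Module.finrank_fintype_fun_eq_card, Fintype.card_fin, Module.finrank_self] at h1 h2 h4
  omega

theorem integral_fourier (m : ℤ) :
    ∫ t : UnitAddCircle, fourier m t = if m = 0 then 1 else 0 := by
  have h := congrFun (fourierCoeff_fourier (T := 1) m) 0
  rw [fourierCoeff, AddCircle.integral_haarAddCircle] at h
  simp only [neg_zero, fourier_zero, one_smul, inv_one, Pi.single_apply] at h
  rw [h]
  simp [eq_comm]

theorem integral_prod_fourier [DecidableEq ι] (c : ι → ℤ) :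
    ∫ y : ι → UnitAddCircle, ∏ B, fourier (c B) (y B) = if c = 0 then 1 else 0 := by
  rw [integral_fintype_prod_volume_eq_prod (fun B t => (fourier (c B) t : ℂ))]
  simp_rw [integral_fourier, Finset.prod_ite_zero]
  simp [funext_iff]

theorem prod_fourier_eq_toCircle {κ : Type*} (s : Finset κ) (c : κ → ℤ)
    (u : κ → UnitAddCircle) :
    ∏ k ∈ s, (fourier (c k) (u k) : ℂ) = AddCircle.toCircle (∑ k ∈ s, c k • u k) := by
  classical
  induction s using Finset.induction_on with
  | empty => simp
  | insert k s hk ih =>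
    rw [Finset.prod_insert hk, Finset.sum_insert hk, ih, AddCircle.toCircle_add, Circle.coe_mul,
      fourier_apply]

/-- Summation by parts: collecting the frequencies by vertex instead of by step produces the
boundary, so orthogonality of characters selects the circulations. -/
theorem prod_fourier_sub [DecidableEq ι] (b : Fin (N + 1) → ι) (ℓ : Fin (N + 1) → ℤ)
    (y : ι → UnitAddCircle) :
    ∏ i, (fourier (ℓ i) (y (b i) - y (b (i + 1))) : ℂ) =
      ∏ B, fourier (boundary b ℓ B) (y B) := by
  rw [prod_fourier_eq_toCircle, prod_fourier_eq_toCircle]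
  congr 2
  have h : ∀ B, boundary b ℓ B • y B =
      ∑ i, ℓ i • ((if b i = B then y B else 0) - (if b (i + 1) = B then y B else 0)) := by
    intro B
    rw [boundary_apply, Finset.sum_apply, Finset.sum_smul]
    refine Finset.sum_congr rfl fun i _ => ?_
    simp only [Pi.smul_apply, Pi.sub_apply, Pi.single_apply, smul_eq_mul, mul_smul, sub_smul,
      ite_smul, one_smul, zero_smul, eq_comm (a := B)]
  simp_rw [h]
  rw [Finset.sum_comm]
  refine Finset.sum_congr rfl fun i _ => ?_
  rw [← Finset.smul_sum, Finset.sum_sub_distrib]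
  simp

/-- The mean of the cyclic kernel counts bounded circulations. -/
theorem integral_prod_dirichlet [DecidableEq ι] (b : Fin (N + 1) → ι) (n : ℕ) :
    ∫ y : ι → UnitAddCircle, ∏ i, dirichlet n (y (b i) - y (b (i + 1))) =
      (Nat.card {ℓ : Fin (N + 1) → ℤ | boundary b ℓ = 0 ∧ ∀ a, 0 ≤ ℓ a ∧ ℓ a < n} : ℂ) := by
  simp only [dirichlet, Finset.prod_univ_sum]
  rw [integral_finsetSum]
  · simp_rw [prod_fourier_sub b (fun i => ((_ : Fin (N + 1) → ℕ) i : ℤ)), integral_prod_fourier]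
    rw [Finset.sum_boole]
    congr 1
    have himg : {ℓ : Fin (N + 1) → ℤ | boundary b ℓ = 0 ∧ ∀ a, 0 ≤ ℓ a ∧ ℓ a < n} =
        (fun (ℓ : Fin (N + 1) → ℕ) i => (ℓ i : ℤ)) ''
          ((Fintype.piFinset fun _ : Fin (N + 1) => Finset.range n).filter
            fun ℓ => boundary b (fun i => (ℓ i : ℤ)) = 0 : Finset (Fin (N + 1) → ℕ)) := by
      ext ℓ
      simp only [Set.mem_ofPred_eq, Finset.coe_filter, Fintype.mem_piFinset, Finset.mem_range,
        Set.mem_image]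
      constructor
      · rintro ⟨h0, h⟩
        have hℓ : (fun i => ((ℓ i).toNat : ℤ)) = ℓ := by
          ext i; exact Int.toNat_of_nonneg (h i).1
        refine ⟨fun i => (ℓ i).toNat, ⟨fun i => ?_, by rw [hℓ]; exact h0⟩, hℓ⟩
        have := h i
        change (ℓ i).toNat < n
        omega
      · rintro ⟨m, ⟨h1, h2⟩, rfl⟩
        exact ⟨h2, fun a => ⟨Int.natCast_nonneg _, Int.ofNat_lt.2 (h1 a)⟩⟩
    rw [himg, Nat.card_image_of_injective, Nat.card_eq_card_toFinset, Finset.toFinset_coe]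
    intro x y hxy
    ext i
    exact Int.ofNat_inj.1 (congrFun hxy i)
  · intro ℓ _
    refine Continuous.integrable_of_hasCompactSupport (by fun_prop) ?_
    exact HasCompactSupport.of_compactSpace _

theorem exists_tendsto_integral_prod_dirichlet (b : Fin (N + 1) → ι)
    (hb : Function.Surjective b) :
    ∃ v : ℝ, Tendsto (fun n : ℕ =>
      (∫ y : ι → UnitAddCircle, ∏ i, dirichlet n (y (b i) - y (b (i + 1)))) /
        (n : ℂ) ^ (N + 1 - Fintype.card ι + 1)) atTop (𝓝 (v : ℂ)) := by
  classical
  obtain ⟨v, hv⟩ := exists_tendsto_card_ker_div_pow (boundary b)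
  refine ⟨v, ?_⟩
  rw [finrank_ker_boundary b hb] at hv
  refine ((Complex.continuous_ofReal.tendsto v).comp hv).congr fun n => ?_
  rw [integral_prod_dirichlet]
  simp

end Boundary

/-! ### Averages of products of translates -/

theorem abs_prod_sub_prod_le {κ : Type*} (s : Finset κ) (a b : κ → ℝ) {M : ℝ} (hM : 1 ≤ M)
    (ha : ∀ i, |a i| ≤ M) (hb : ∀ i, |b i| ≤ M) :
    |∏ i ∈ s, a i - ∏ i ∈ s, b i| ≤ M ^ s.card * ∑ i ∈ s, |a i - b i| := by
  classical
  induction s using Finset.induction_on with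
  | empty => simp
  | insert k s hk ih =>
    rw [Finset.prod_insert hk, Finset.prod_insert hk, Finset.sum_insert hk,
      Finset.card_insert_of_notMem hk]
    have h1 : a k * ∏ i ∈ s, a i - b k * ∏ i ∈ s, b i =
        (a k - b k) * ∏ i ∈ s, a i + b k * (∏ i ∈ s, a i - ∏ i ∈ s, b i) := by ring
    have h2 : |∏ i ∈ s, a i| ≤ M ^ s.card := by
      rw [Finset.abs_prod, ← Finset.prod_const]
      exact Finset.prod_le_prod (fun i _ => abs_nonneg _) fun i _ => ha i
    have h0 : 0 ≤ ∑ i ∈ s, |a i - b i| := Finset.sum_nonneg fun i _ => abs_nonneg _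
    have hp : (0 : ℝ) ≤ M ^ s.card := by positivity
    rw [h1]
    calc _ ≤ |a k - b k| * |∏ i ∈ s, a i| + |b k| * |∏ i ∈ s, a i - ∏ i ∈ s, b i| := by
            rw [← abs_mul, ← abs_mul]; exact abs_add_le _ _
      _ ≤ |a k - b k| * M ^ s.card + M * (M ^ s.card * ∑ i ∈ s, |a i - b i|) := by
            gcongr
            exact hb k
      _ ≤ M ^ (s.card + 1) * (|a k - b k| + ∑ i ∈ s, |a i - b i|) := by
            rw [pow_succ]
            nlinarith [mul_nonneg (mul_nonneg (abs_nonneg (a k - b k)) hp) (sub_nonneg.2 hM)]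

theorem prod_le_sum_pow {κ : Type*} [Fintype κ] [Nonempty κ] (a : κ → ℝ) (ha : ∀ i, 0 ≤ a i) :
    ∏ i, a i ≤ ∑ i, a i ^ Fintype.card κ := by
  obtain ⟨k, -, hk⟩ := Finset.exists_max_image Finset.univ a Finset.univ_nonempty
  calc ∏ i, a i ≤ ∏ _i : κ, a k := Finset.prod_le_prod (fun i _ => ha i) fun i hi => hk i hi
    _ = a k ^ Fintype.card κ := by simp
    _ ≤ _ := Finset.single_le_sum (f := fun i => a i ^ Fintype.card κ)
      (fun i _ => pow_nonneg (ha i) _) (Finset.mem_univ k)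

theorem prod_min_le_prod {κ : Type*} [Fintype κ] (a : κ → ℝ) (ha : ∀ i, 0 ≤ a i) {M : ℝ}
    (hM : 0 ≤ M) : ∏ i, min (a i) M ≤ ∏ i, a i :=
  Finset.prod_le_prod (fun i _ => le_min (ha i) hM) fun _ _ => min_le_left _ _

/-- If the largest factor is at most `M`, nothing is truncated; otherwise its power dominates the
whole product. -/
theorem prod_sub_prod_min_le {κ : Type*} [Fintype κ] [Nonempty κ] (a : κ → ℝ)
    (ha : ∀ i, 0 ≤ a i) {M : ℝ} (hM : 0 ≤ M) :
    ∏ i, a i - ∏ i, min (a i) M ≤ ∑ i, if M < a i then a i ^ Fintype.card κ else 0 := by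
  have hnn : ∀ i, 0 ≤ if M < a i then a i ^ Fintype.card κ else 0 := fun i => by
    split_ifs
    · exact pow_nonneg (ha i) _
    · exact le_rfl
  obtain ⟨k, -, hk⟩ := Finset.exists_max_image Finset.univ a Finset.univ_nonempty
  by_cases hMk : M < a k
  · have h0 : 0 ≤ ∏ i, min (a i) M := Finset.prod_nonneg fun i _ => le_min (ha i) hM
    calc ∏ i, a i - ∏ i, min (a i) M ≤ ∏ i, a i := by linarith
      _ ≤ ∏ _i : κ, a k := Finset.prod_le_prod (fun i _ => ha i) fun i hi => hk i hi
      _ = if M < a k then a k ^ Fintype.card κ else 0 := by simp [hMk]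
      _ ≤ _ := Finset.single_le_sum
        (f := fun i => if M < a i then a i ^ Fintype.card κ else 0)
        (fun i _ => hnn i) (Finset.mem_univ k)
  · have : ∀ i, min (a i) M = a i := fun i =>
      min_eq_left ((hk i (Finset.mem_univ i)).trans (not_lt.1 hMk))
    simp only [this, sub_self]
    exact Finset.sum_nonneg fun i _ => hnn i

section Translates

variable {d : ℕ}

/-- Continuity of translation in `L¹`: approximate by a continuous function, which is uniformly
continuous on the compact torus. -/
theorem exists_integral_abs_translate_sub_le (F : (Fin d → UnitAddCircle) → ℝ)
    (hF : Integrable F) {ε : ℝ} (hε : 0 < ε) :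
    ∃ δ > 0, ∀ u : Fin d → UnitAddCircle, ‖u‖ < δ → ∫ a, |F (u + a) - F a| ≤ ε := by
  obtain ⟨φ, hφ, hφi⟩ := hF.exists_boundedContinuous_integral_sub_le (ε := ε / 3) (by positivity)
  have huc := CompactSpace.uniformContinuous_of_continuous φ.continuous
  obtain ⟨δ, hδ, hδ'⟩ := Metric.uniformContinuous_iff.1 huc (ε / 3) (by positivity)
  refine ⟨δ, hδ, fun u hu => ?_⟩
  have hFu : Integrable fun a => F (u + a) := hF.comp_add_left u
  have hφu : Integrable fun a => φ (u + a) := hφi.comp_add_left u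
  have hd : Integrable fun a => |F a - φ a| := (hF.sub hφi).abs
  have hdu : Integrable fun a => |F (u + a) - φ (u + a)| := (hFu.sub hφu).abs
  have hdc : Integrable fun a => |F (u + a) - φ (u + a)| + ε / 3 := hdu.add (integrable_const _)
  calc ∫ a, |F (u + a) - F a| ≤
      ∫ a, (|F (u + a) - φ (u + a)| + ε / 3 + |F a - φ a|) := by
        refine integral_mono (hFu.sub hF).abs
          (hdc.add hd) fun a => ?_
        have h1 : |φ (u + a) - φ a| < ε / 3 := by
          have := hδ' (a := u + a) (b := a) (by simpa [dist_eq_norm] using hu)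
          rwa [Real.dist_eq] at this
        have h2 := abs_sub_le (F (u + a)) (φ (u + a)) (F a)
        have h3 := abs_sub_le (φ (u + a)) (φ a) (F a)
        rw [abs_sub_comm (φ a)] at h3
        simp only
        linarith
    _ = (∫ a, |F a - φ a|) + ε / 3 + ∫ a, |F a - φ a| := by
        rw [integral_add hdc hd, integral_add hdu (integrable_const _),
          integral_add_left_eq_self (fun a => |F a - φ a|)]
        simp
    _ ≤ ε := by
        simp only [Real.norm_eq_abs] at hφ
        linarith

variable {ι : Type*} [Fintype ι]

/-- The diagonal average of `∏_B F (z_B)`. -/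
def diagonalMean (F : (Fin d → UnitAddCircle) → ℝ) (z : ι → Fin d → UnitAddCircle) : ℝ :=
  ∫ a, ∏ B, F (z B + a)

theorem diagonalMean_sub_const (F : (Fin d → UnitAddCircle) → ℝ)
    (z : ι → Fin d → UnitAddCircle) (u : Fin d → UnitAddCircle) :
    diagonalMean F (fun B => z B - u) = diagonalMean F z := by
  unfold diagonalMean
  rw [← integral_add_left_eq_self (fun a => ∏ B, F (z B - u + a)) u]
  simp [← add_assoc]

variable {F : (Fin d → UnitAddCircle) → ℝ}

theorem diagonalMean_nonneg (hF0 : ∀ a, 0 ≤ F a) (z : ι → Fin d → UnitAddCircle) :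
    0 ≤ diagonalMean F z :=
  integral_nonneg fun _ => Finset.prod_nonneg fun _ _ => hF0 _

variable [Nonempty ι]

theorem integrable_prod_translate (hF : Measurable F) (hF0 : ∀ a, 0 ≤ F a)
    (hFk : Integrable fun a => F a ^ Fintype.card ι) (z : ι → Fin d → UnitAddCircle) :
    Integrable fun a => ∏ B, F (z B + a) := by
  refine Integrable.mono' (g := fun a => ∑ B, F (z B + a) ^ Fintype.card ι)
    (integrable_finsetSum _ fun B _ => hFk.comp_add_left (z B)) ?_ (ae_of_all _ fun a => ?_)
  · exact (Finset.measurable_prod _ fun B _ => by fun_prop).aestronglyMeasurable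
  · rw [Real.norm_eq_abs, abs_of_nonneg (Finset.prod_nonneg fun B _ => hF0 _)]
    exact prod_le_sum_pow (fun B => F (z B + a)) fun B => hF0 _

/-- A bound uniform in `z` that needs no boundedness of `F`. The factor `card ι`, which Hölder's
inequality would remove, is harmless here. -/
theorem diagonalMean_le (hF : Measurable F) (hF0 : ∀ a, 0 ≤ F a)
    (hFk : Integrable fun a => F a ^ Fintype.card ι) (z : ι → Fin d → UnitAddCircle) :
    diagonalMean F z ≤ Fintype.card ι * ∫ a, F a ^ Fintype.card ι := by
  have hi : ∀ B, Integrable fun a => F (z B + a) ^ Fintype.card ι :=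
    fun B => hFk.comp_add_left (z B)
  calc diagonalMean F z ≤ ∫ a, ∑ B, F (z B + a) ^ Fintype.card ι := by
        refine integral_mono (integrable_prod_translate hF hF0 hFk z)
          (integrable_finsetSum _ fun B _ => hi B) fun a => ?_
        exact prod_le_sum_pow (fun B => F (z B + a)) fun B => hF0 _
    _ = _ := by
        rw [integral_finsetSum _ fun B _ => hi B]
        simp_rw [integral_add_left_eq_self (fun a => F a ^ Fintype.card ι)]
        simp

theorem diagonalMean_truncate_sub_le (hF : Measurable F) (hF0 : ∀ a, 0 ≤ F a)
    (hFk : Integrable fun a => F a ^ Fintype.card ι) {M : ℝ} (hM : 0 ≤ M)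
    (z : ι → Fin d → UnitAddCircle) :
    |diagonalMean F z - diagonalMean (fun a => min (F a) M) z| ≤
      Fintype.card ι * ∫ a, if M < F a then F a ^ Fintype.card ι else 0 := by
  have hmin0 : ∀ a, 0 ≤ min (F a) M := fun a => le_min (hF0 a) hM
  have hmeas : Measurable fun a => min (F a) M := hF.min measurable_const
  have hset : MeasurableSet {a | M < F a} := measurableSet_lt measurable_const hF
  have htail : Integrable fun a => if M < F a then F a ^ Fintype.card ι else 0 := by
    simpa [Set.indicator_apply] using! hFk.indicator hset
  have hmink : Integrable fun a => min (F a) M ^ Fintype.card ι := by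
    refine hFk.mono' (by fun_prop) (ae_of_all _ fun a => ?_)
    rw [Real.norm_eq_abs, abs_of_nonneg (pow_nonneg (hmin0 a) _)]
    exact pow_le_pow_left₀ (hmin0 a) (min_le_left _ _) _
  have hi : ∀ B, Integrable fun a => if M < F (z B + a) then F (z B + a) ^ Fintype.card ι else 0 :=
    fun B => htail.comp_add_left (z B)
  unfold diagonalMean
  rw [← integral_sub (integrable_prod_translate hF hF0 hFk z)
    (integrable_prod_translate hmeas hmin0 hmink z), abs_of_nonneg]
  · calc _ ≤ ∫ a, ∑ B, if M < F (z B + a) then F (z B + a) ^ Fintype.card ι else 0 := by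
          refine integral_mono ((integrable_prod_translate hF hF0 hFk z).sub
            (integrable_prod_translate hmeas hmin0 hmink z))
            (integrable_finsetSum _ fun B _ => hi B) fun a => ?_
          exact prod_sub_prod_min_le (fun B => F (z B + a)) (fun B => hF0 _) hM
      _ = _ := by
          rw [integral_finsetSum _ fun B _ => hi B]
          simp_rw [integral_add_left_eq_self
            (fun a => if M < F a then F a ^ Fintype.card ι else 0)]
          simp
  · refine integral_nonneg fun a => sub_nonneg.2 ?_
    exact prod_min_le_prod (fun B => F (z B + a)) (fun B => hF0 _) hM

theorem exists_integral_tail_le (hF : Measurable F) (k : ℕ)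
    (hFk : Integrable fun a => F a ^ k) {ε : ℝ} (hε : 0 < ε) :
    ∃ M : ℝ, 1 ≤ M ∧ ∫ a, (if M < F a then F a ^ k else 0) ≤ ε := by
  have h : Tendsto (fun M : ℕ => ∫ a, if (M : ℝ) < F a then F a ^ k else 0) atTop
      (𝓝 (∫ _a : Fin d → UnitAddCircle, (0 : ℝ))) := by
    refine tendsto_integral_of_dominated_convergence (fun a => |F a ^ k|)
      (fun M => ?_) hFk.abs (fun M => ae_of_all _ fun a => ?_) (ae_of_all _ fun a => ?_)
    · exact (Measurable.ite (measurableSet_lt measurable_const hF) (by fun_prop)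
        measurable_const).aestronglyMeasurable
    · split_ifs
      · exact le_rfl
      · simp
    · refine tendsto_const_nhds.congr' ?_
      obtain ⟨M₀, hM₀⟩ := exists_nat_ge (F a)
      filter_upwards [eventually_ge_atTop M₀] with M hM
      have : (M₀ : ℝ) ≤ M := by exact_mod_cast hM
      rw [if_neg (by linarith)]
  rw [integral_zero] at h
  obtain ⟨M, hM1, hM2⟩ := ((h.eventually (ge_mem_nhds hε)).and (eventually_ge_atTop 1)).exists
  exact ⟨M, by exact_mod_cast hM2, hM1⟩

/-- The diagonal average is continuous at the diagonal. -/
theorem exists_abs_diagonalMean_sub_le (hF : Measurable F) (hF0 : ∀ a, 0 ≤ F a)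
    (hFk : Integrable fun a => F a ^ Fintype.card ι) {ε : ℝ} (hε : 0 < ε) :
    ∃ δ > 0, ∀ z : ι → Fin d → UnitAddCircle, (∀ B, ‖z B‖ < δ) →
      |diagonalMean F z - ∫ a, F a ^ Fintype.card ι| ≤ ε := by
  set k := Fintype.card ι with hk
  have hkpos : (0 : ℝ) < k := by exact_mod_cast Fintype.card_pos
  obtain ⟨M, hM1, hM⟩ := exists_integral_tail_le hF k hFk (ε := ε / (3 * k)) (by positivity)
  have hM0 : 0 ≤ M := by linarith
  set F' : (Fin d → UnitAddCircle) → ℝ := fun a => min (F a) M with hF'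
  have hF'm : Measurable F' := hF.min measurable_const
  have hF'0 : ∀ a, 0 ≤ F' a := fun a => le_min (hF0 a) hM0
  have hF'M : ∀ a, |F' a| ≤ M := fun a => by rw [abs_of_nonneg (hF'0 a)]; exact min_le_right _ _
  have hF'i : Integrable F' :=
    Integrable.of_bound hF'm.aestronglyMeasurable M (ae_of_all _ hF'M)
  have hF'k : Integrable fun a => F' a ^ k :=
    Integrable.of_bound (by fun_prop) (M ^ k) (ae_of_all _ fun a => by
      rw [norm_pow]; exact pow_le_pow_left₀ (norm_nonneg _) (hF'M a) _)
  -- For factors bounded by `M`, telescoping costs `M ^ k` times a sum of `k` translation errors,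
  -- whence this tolerance; the two truncation errors take the other two thirds of `ε`.
  obtain ⟨δ, hδ, hδ'⟩ := exists_integral_abs_translate_sub_le F' hF'i
    (ε := ε / (3 * k * M ^ k)) (by positivity)
  refine ⟨δ, hδ, fun z hz => ?_⟩
  have hzero : ∀ f : (Fin d → UnitAddCircle) → ℝ,
      diagonalMean f (fun _ : ι => 0) = ∫ a, f a ^ k := fun f => by
    simp [diagonalMean, hk]
  have hthird : k * (ε / (3 * k)) = ε / 3 := by field_simp
  have h1 : |diagonalMean F z - diagonalMean F' z| ≤ ε / 3 :=
    (diagonalMean_truncate_sub_le hF hF0 hFk hM0 z).trans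
      (hthird ▸ mul_le_mul_of_nonneg_left hM hkpos.le)
  have h2 : |diagonalMean F (fun _ : ι => 0) - diagonalMean F' (fun _ : ι => 0)| ≤ ε / 3 :=
    (diagonalMean_truncate_sub_le hF hF0 hFk hM0 _).trans
      (hthird ▸ mul_le_mul_of_nonneg_left hM hkpos.le)
  have h3 : |diagonalMean F' z - diagonalMean F' (fun _ : ι => 0)| ≤ ε / 3 := by
    have hi0 := integrable_prod_translate hF'm hF'0 hF'k (fun _ : ι => 0)
    have hiz := integrable_prod_translate hF'm hF'0 hF'k z
    have hiB : ∀ B, Integrable fun a => |F' (z B + a) - F' a| :=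
      fun B => ((hF'i.comp_add_left (z B)).sub hF'i).abs
    unfold diagonalMean
    rw [← integral_sub hiz hi0]
    refine (abs_integral_le_integral_abs).trans ?_
    calc _ ≤ ∫ a, M ^ k * ∑ B, |F' (z B + a) - F' a| := by
          refine integral_mono (hiz.sub hi0).abs
            ((integrable_finsetSum _ fun B _ => hiB B).const_mul _) fun a => ?_
          have := abs_prod_sub_prod_le Finset.univ (fun B => F' (z B + a))
            (fun _ : ι => F' (0 + a)) hM1 (fun B => hF'M _) (fun B => hF'M _)
          simpa [hk] using this
      _ = M ^ k * ∑ B, ∫ a, |F' (z B + a) - F' a| := by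
          rw [integral_const_mul, integral_finsetSum _ fun B _ => hiB B]
      _ ≤ M ^ k * ∑ _B : ι, ε / (3 * k * M ^ k) := by
          gcongr with B
          exact hδ' _ (hz B)
      _ = ε / 3 := by
          rw [Finset.sum_const, Finset.card_univ, ← hk, nsmul_eq_mul]
          field_simp
  rw [← hzero F]
  rw [abs_le] at *
  constructor <;> linarith [h1.1, h1.2, h2.1, h2.2, h3.1, h3.2]

end Translates

/-! ### The cyclic kernel on the torus -/

section TorusKernel

variable {d N : ℕ} {ι : Type*}

/-- The product of the kernels over all coordinates and all steps of the closed walk `b`. -/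
def torusKernel (b : Fin (N + 1) → ι) (n : ℕ) (z : ι → Fin d → UnitAddCircle) : ℂ :=
  ∏ j, ∏ i, dirichlet n (z (b i) j - z (b (i + 1)) j)

/-- The product of the decay profiles over all coordinates and all steps. -/
def torusDecay (b : Fin (N + 1) → ι) (n : ℕ) (z : ι → Fin d → UnitAddCircle) : ℝ :=
  ∏ j, ∏ i, decay n (z (b i) j - z (b (i + 1)) j)

theorem continuous_torusKernel (b : Fin (N + 1) → ι) (n : ℕ) :
    Continuous (torusKernel (d := d) b n) := by
  have := continuous_dirichlet n
  unfold torusKernel; fun_prop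

theorem continuous_torusDecay (b : Fin (N + 1) → ι) (n : ℕ) :
    Continuous (torusDecay (d := d) b n) := by
  have := continuous_decay n
  unfold torusDecay; fun_prop

theorem torusKernel_add_const (b : Fin (N + 1) → ι) (n : ℕ) (z : ι → Fin d → UnitAddCircle)
    (a : Fin d → UnitAddCircle) :
    torusKernel b n (fun B => z B + a) = torusKernel b n z := by
  simp [torusKernel]

theorem torusDecay_pos (b : Fin (N + 1) → ι) (n : ℕ) (z : ι → Fin d → UnitAddCircle) :
    0 < torusDecay b n z :=
  Finset.prod_pos fun _ _ => Finset.prod_pos fun _ _ => decay_pos _ _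

theorem torusDecay_le_decay (b : Fin (N + 1) → ι) (n : ℕ) (z : ι → Fin d → UnitAddCircle)
    (j : Fin d) (i : Fin (N + 1)) :
    torusDecay b n z ≤ decay n (z (b i) j - z (b (i + 1)) j) := by
  have h0 := fun j i => (decay_pos n (z (b i) j - z (b (i + 1)) j)).le
  have h1 := fun j i => decay_le_one n (z (b i) j - z (b (i + 1)) j)
  unfold torusDecay
  rw [← Finset.mul_prod_erase _ _ (Finset.mem_univ j),
    ← Finset.mul_prod_erase _ _ (Finset.mem_univ i), mul_assoc]
  refine mul_le_of_le_one_right (h0 j i) (mul_le_one₀ ?_ ?_ ?_)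
  · exact Finset.prod_le_one (fun i _ => h0 j i) fun i _ => h1 j i
  · exact Finset.prod_nonneg fun j _ => Finset.prod_nonneg fun i _ => h0 j i
  · exact Finset.prod_le_one (fun j _ => Finset.prod_nonneg fun i _ => h0 j i) fun j _ =>
      Finset.prod_le_one (fun i _ => h0 j i) fun i _ => h1 j i

theorem torusDecay_le_one (b : Fin (N + 1) → ι) (n : ℕ) (z : ι → Fin d → UnitAddCircle) :
    torusDecay b n z ≤ 1 :=
  Finset.prod_le_one (fun _ _ => Finset.prod_nonneg fun _ _ => (decay_pos _ _).le) fun _ _ =>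
    Finset.prod_le_one (fun _ _ => (decay_pos _ _).le) fun _ _ => decay_le_one _ _

theorem norm_torusKernel_le (b : Fin (N + 1) → ι) (n : ℕ) (z : ι → Fin d → UnitAddCircle) :
    ‖torusKernel b n z‖ ≤ (2 * n : ℝ) ^ (d * (N + 1)) * torusDecay b n z := by
  have h : (2 * n : ℝ) ^ (d * (N + 1)) * torusDecay b n z =
      ∏ j, ∏ i, (2 * n * decay n (z (b i) j - z (b (i + 1)) j)) := by
    simp only [torusDecay, Finset.prod_mul_distrib, Finset.prod_const, Finset.card_univ,
      Fintype.card_fin]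
    rw [← mul_pow, ← mul_pow, ← pow_mul, mul_comm (N + 1) d]
  rw [h, torusKernel, norm_prod]
  refine Finset.prod_le_prod (fun _ _ => norm_nonneg _) fun j _ => ?_
  rw [norm_prod]
  exact Finset.prod_le_prod (fun _ _ => norm_nonneg _) fun i _ => norm_dirichlet_le _ _

/-- A point whose coordinates are not all close has a long step. -/
theorem exists_long_step (b : Fin (N + 1) → ι) (hb : Function.Surjective b)
    (z : ι → Fin d → UnitAddCircle) {δ : ℝ} (hδ : 0 < δ) {B : ι} (hB : δ ≤ ‖z B - z (b 0)‖) :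
    ∃ j i, δ / (N + 1) ≤ ‖z (b i) j - z (b (i + 1)) j‖ := by
  by_contra! hcon
  have hη : 0 < δ / (N + 1) := by positivity
  have hstep : ∀ i, ‖z (b (i + 1)) - z (b i)‖ < δ / (N + 1) := fun i => by
    rw [norm_sub_rev, pi_norm_lt_iff hη]
    exact fun j => hcon j i
  have hpath : ∀ i : Fin (N + 1), ‖z (b i) - z (b 0)‖ ≤ i * (δ / (N + 1)) := by
    intro i
    induction i using Fin.induction with
    | zero => simp
    | succ i ih =>
      have h1 := hstep i.castSucc
      rw [Fin.coeSucc_eq_succ] at h1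
      have h2 := norm_add_le (z (b i.succ) - z (b i.castSucc)) (z (b i.castSucc) - z (b 0))
      rw [sub_add_sub_cancel] at h2
      rw [Fin.val_castSucc] at ih
      rw [Fin.val_succ]
      push_cast
      linarith
  obtain ⟨i, rfl⟩ := hb B
  have h3 := hB.trans (hpath i)
  have h4 : ((i : ℕ) : ℝ) ≤ N := by exact_mod_cast Nat.le_of_lt_succ i.2
  have h5 : ((i : ℕ) : ℝ) * (δ / (N + 1)) ≤ N * (δ / (N + 1)) := by gcongr
  have h6 : (N + 1 : ℝ) * (δ / (N + 1)) = δ := by field_simp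
  linarith

variable [Fintype ι]

theorem integral_torusKernel (b : Fin (N + 1) → ι) (n : ℕ) :
    ∫ z : ι → Fin d → UnitAddCircle, torusKernel b n z =
      (∫ y : ι → UnitAddCircle, ∏ i, dirichlet n (y (b i) - y (b (i + 1)))) ^ d := by
  have hm : Measurable fun y : ι → UnitAddCircle =>
      ∏ i, dirichlet n (y (b i) - y (b (i + 1))) := by
    have := continuous_dirichlet n
    exact Continuous.measurable (by fun_prop)
  have := integral_prod_swap ι (Fin d) _ hm
  rw [Fintype.card_fin] at this
  exact this

theorem exists_integral_torusDecay_rpow_le (d : ℕ) (b : Fin (N + 1) → ι)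
    (hb : Function.Surjective b) :
    ∃ s : ℝ, 0 < s ∧ s < 1 ∧ ∃ C : ℝ, 0 ≤ C ∧ ∀ n : ℕ, 0 < n →
      ∫ z : ι → Fin d → UnitAddCircle, torusDecay b n z ^ s ≤
        C / (n : ℝ) ^ (d * (Fintype.card ι - 1)) := by
  obtain ⟨s, hs0, hs1, C, hC⟩ := exists_lintegral_prod_decay_rpow_le b hb
  refine ⟨s, hs0, hs1, (C : ℝ) ^ d, by positivity, fun n hn => ?_⟩
  have hn' : (0 : ℝ) < n := by exact_mod_cast hn
  have hcont := continuous_decay n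
  set g : (ι → UnitAddCircle) → ℝ := fun y => (∏ i, decay n (y (b i) - y (b (i + 1)))) ^ s
  have hg0 : ∀ y, 0 ≤ g y := fun y =>
    Real.rpow_nonneg (Finset.prod_nonneg fun i _ => (decay_pos _ _).le) _
  have hg : Measurable g := by
    have : Continuous fun y : ι → UnitAddCircle => ∏ i, decay n (y (b i) - y (b (i + 1))) := by
      fun_prop
    exact this.measurable.pow_const s
  have h1 : ∫ z : ι → Fin d → UnitAddCircle, torusDecay b n z ^ s = (∫ y, g y) ^ d := by
    rw [← Fintype.card_fin d, ← integral_prod_swap ι (Fin d) g hg, Fintype.card_fin]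
    refine integral_congr_ae (ae_of_all _ fun z => ?_)
    exact (Real.finsetProd_rpow _ _
      (fun j _ => Finset.prod_nonneg fun i _ => (decay_pos _ _).le) s).symm
  have h2 : ∫ y, g y ≤ C / (n : ℝ) ^ (Fintype.card ι - 1) := by
    rw [integral_eq_lintegral_of_nonneg_ae (ae_of_all _ hg0) hg.aestronglyMeasurable]
    refine (ENNReal.toReal_mono ?_ (hC n hn)).trans (le_of_eq ?_)
    · refine ENNReal.div_ne_top ENNReal.coe_ne_top (pow_ne_zero _ ?_)
      exact_mod_cast hn.ne'
    · simp
  rw [h1]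
  refine (pow_le_pow_left₀ (integral_nonneg hg0) h2 d).trans (le_of_eq ?_)
  rw [div_pow, ← pow_mul, mul_comm d]

/-! ### Concentration of the kernel on the diagonal -/

variable {F : (Fin d → UnitAddCircle) → ℝ}

theorem integrable_prod_density (hF : Integrable F) :
    Integrable fun z : ι → Fin d → UnitAddCircle => ∏ B, F (z B) :=
  Integrable.fintype_prod (f := fun _ => F) fun _ => hF

theorem stronglyMeasurable_diagonalMean (hF : Measurable F) :
    StronglyMeasurable (diagonalMean (ι := ι) F) := by
  have : Measurable fun q : (ι → Fin d → UnitAddCircle) × (Fin d → UnitAddCircle) =>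
      ∏ B, F (q.1 B + q.2) := by
    refine Finset.measurable_prod _ fun B _ => hF.comp ?_
    fun_prop
  exact this.stronglyMeasurable.integral_prod_right

/-- The shear `(a, z) ↦ (a, z + a)` preserves the measure and the kernel ignores `a`, so averaging
over `a` affects only the density. -/
theorem integral_prod_density_mul_kernel (hF : Measurable F) (hFi : Integrable F)
    (b : Fin (N + 1) → ι) (n : ℕ) :
    ∫ z : ι → Fin d → UnitAddCircle, ((∏ B, F (z B) : ℝ) : ℂ) * torusKernel b n z =
      ∫ z : ι → Fin d → UnitAddCircle, (diagonalMean F z : ℂ) * torusKernel b n z := by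
  let H : (ι → Fin d → UnitAddCircle) → ℂ := fun z => ((∏ B, F (z B) : ℝ) : ℂ) * torusKernel b n z
  have hK := continuous_torusKernel (d := d) b n
  have hHm : Measurable H := by
    refine Measurable.mul ?_ hK.measurable
    exact Complex.measurable_ofReal.comp (Finset.measurable_prod _ fun B _ => by fun_prop)
  have hHi : Integrable H := by
    refine Integrable.mul_bdd (c := (2 * n : ℝ) ^ (d * (N + 1)))
      (integrable_prod_density hFi).ofReal hK.aestronglyMeasurable (ae_of_all _ fun z => ?_)
    refine (norm_torusKernel_le b n z).trans ?_
    exact mul_le_of_le_one_right (by positivity) (torusDecay_le_one b n z)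
  have hmp : MeasurePreserving (fun q : (Fin d → UnitAddCircle) × (ι → Fin d → UnitAddCircle) =>
        (q.1, fun B => q.2 B + q.1))
      (volume.prod volume) (volume.prod volume) := by
    refine (MeasurePreserving.id volume).skew_product
      (g := fun (a : Fin d → UnitAddCircle) (z : ι → Fin d → UnitAddCircle) (B : ι) => z B + a)
      ?_ (ae_of_all _ fun a => ?_)
    · refine measurable_pi_lambda _ fun B => ?_
      exact Measurable.add (by fun_prop) (by fun_prop)
    · have : (volume : Measure (ι → Fin d → UnitAddCircle)).IsAddLeftInvariant :=
        Measure.pi.isAddLeftInvariant _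
      simp_rw [add_comm _ a]
      exact map_add_left_eq_self (volume : Measure (ι → Fin d → UnitAddCircle)) (fun _ => a)
  have hHi2 : Integrable (fun q : (Fin d → UnitAddCircle) × (ι → Fin d → UnitAddCircle) => H q.2)
      (volume.prod volume) := hHi.comp_snd _
  have hint : Integrable (fun q : (Fin d → UnitAddCircle) × (ι → Fin d → UnitAddCircle) =>
      H (fun B => q.2 B + q.1))
      (volume.prod volume) := hmp.integrable_comp_of_integrable hHi2
  calc ∫ z, H z = ∫ q : (Fin d → UnitAddCircle) × (ι → Fin d → UnitAddCircle),
          H q.2 ∂(volume.prod volume) := by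
        rw [integral_prod _ hHi2]; simp
    _ = ∫ q : (Fin d → UnitAddCircle) × (ι → Fin d → UnitAddCircle),
          H (fun B => q.2 B + q.1) ∂(volume.prod volume) := by
        rw [← hmp.map_eq, integral_map hmp.aemeasurable, hmp.map_eq]
        exact (hHm.comp measurable_snd).aestronglyMeasurable
    _ = ∫ z : ι → Fin d → UnitAddCircle, ∫ a : Fin d → UnitAddCircle, H (fun B => z B + a) := by
        rw [integral_prod_symm _ hint]
    _ = _ := by
        refine integral_congr_ae (ae_of_all _ fun z => ?_)
        simp only [H, torusKernel_add_const, diagonalMean]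
        rw [integral_mul_const, integral_complex_ofReal]

/-- After averaging over translations, `diagonalMean F` is compared with its value `I` on the
diagonal. Near the diagonal the difference is small; elsewhere it is merely bounded, but a positive
power of the decay product is small there. -/
theorem tendsto_integral_prod_density_mul_kernel [Nonempty ι] (hF : Measurable F)
    (hF0 : ∀ a, 0 ≤ F a) (hFi : Integrable F) (hFk : Integrable fun a => F a ^ Fintype.card ι)
    (b : Fin (N + 1) → ι) (hb : Function.Surjective b) {v : ℝ}
    (hv : Tendsto (fun n : ℕ =>
      (∫ y : ι → UnitAddCircle, ∏ i, dirichlet n (y (b i) - y (b (i + 1)))) /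
        (n : ℂ) ^ (N + 1 - Fintype.card ι + 1)) atTop (𝓝 (v : ℂ))) :
    Tendsto (fun n : ℕ =>
      (∫ z : ι → Fin d → UnitAddCircle, ((∏ B, F (z B) : ℝ) : ℂ) * torusKernel b n z) /
        ((n : ℂ) ^ d) ^ (N + 1 - Fintype.card ι + 1)) atTop
      (𝓝 (((∫ a, F a ^ Fintype.card ι) * v ^ d : ℝ) : ℂ)) := by
  set k := Fintype.card ι with hk
  set I : ℝ := ∫ a, F a ^ k with hI
  have hkN : k ≤ N + 1 := by simpa using Fintype.card_le_of_surjective b hb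
  have hk1 : 1 ≤ k := Fintype.card_pos
  set r := N + 1 - k + 1
  have hmain : Tendsto (fun n : ℕ => (I : ℂ) *
      ((∫ z : ι → Fin d → UnitAddCircle, torusKernel b n z) / ((n : ℂ) ^ d) ^ r)) atTop
      (𝓝 ((I * v ^ d : ℝ) : ℂ)) := by
    have := (hv.pow d).const_mul (I : ℂ)
    push_cast
    refine this.congr fun n => ?_
    rw [integral_torusKernel, div_pow, ← pow_mul, ← pow_mul, mul_comm d]
  obtain ⟨s, hs0, hs1, C, hC0, hC⟩ := exists_integral_torusDecay_rpow_le d b hb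
  have hI0 : 0 ≤ I := integral_nonneg fun a => pow_nonneg (hF0 a) _
  set A : ℝ := 2 ^ (d * (N + 1)) * C
  have hA0 : 0 ≤ A := by positivity
  have hbound : ∀ ε > 0, ∃ η > 0, ∀ n : ℕ, 0 < n →
      ‖(∫ z : ι → Fin d → UnitAddCircle, ((∏ B, F (z B) : ℝ) : ℂ) * torusKernel b n z) /
        ((n : ℂ) ^ d) ^ r - (I : ℂ) *
      ((∫ z : ι → Fin d → UnitAddCircle, torusKernel b n z) / ((n : ℂ) ^ d) ^ r)‖ ≤
      A * (ε + (k + 1) * I * (1 + n * η) ^ (-(1 - s))) := by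
    intro ε hε
    obtain ⟨δ, hδ, hδ'⟩ := exists_abs_diagonalMean_sub_le hF hF0 hFk hε
    refine ⟨δ / (N + 1), by positivity, fun n hn => ?_⟩
    have hn' : (0 : ℝ) < n := by exact_mod_cast hn
    set η := δ / (N + 1 : ℝ)
    have hη : 0 < η := by positivity
    set Q : ℝ := ε + (k + 1) * I * (1 + n * η) ^ (-(1 - s))
    have hQ0 : 0 ≤ Q := by positivity
    have hpt : ∀ z : ι → Fin d → UnitAddCircle,
        torusDecay b n z * |diagonalMean F z - I| ≤ torusDecay b n z ^ s * Q := by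
      intro z
      set W := torusDecay b n z with hW
      have hW0 : 0 < W := torusDecay_pos b n z
      have hW1 : W ≤ 1 := torusDecay_le_one b n z
      -- The power `s` keeps an integral of critical order; the power `1 - s` is spent on smallness
      -- away from the diagonal.
      have hsplit : W = W ^ s * W ^ (1 - s) := by
        rw [← Real.rpow_add hW0, add_sub_cancel, Real.rpow_one]
      have hQε : ε ≤ Q := le_add_of_nonneg_right (by positivity)
      have hGI : |diagonalMean F z - I| ≤ (k + 1) * I := by
        have h1 := diagonalMean_le hF hF0 hFk z
        have h2 := diagonalMean_nonneg hF0 z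
        have hkr : (1 : ℝ) ≤ k := by exact_mod_cast hk1
        rw [abs_le]
        constructor <;> nlinarith
      have hsuff : W ^ (1 - s) * |diagonalMean F z - I| ≤ Q := by
        by_cases hclose : ∀ B, ‖z B - z (b 0)‖ < δ
        · have h1 := hδ' (fun B => z B - z (b 0)) hclose
          rw [diagonalMean_sub_const] at h1
          refine le_trans (mul_le_of_le_one_left (abs_nonneg _) ?_) (h1.trans hQε)
          exact Real.rpow_le_one hW0.le hW1 (by linarith)
        · push Not at hclose
          obtain ⟨B, hB⟩ := hclose
          obtain ⟨j, i, hij⟩ := exists_long_step b hb z hδ hB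
          have h1 : W ≤ (1 + n * η)⁻¹ := by
            refine (torusDecay_le_decay b n z j i).trans ?_
            unfold decay
            gcongr
          have h2 : W ^ (1 - s) ≤ (1 + n * η) ^ (-(1 - s)) := by
            rw [Real.rpow_neg (by positivity), ← Real.inv_rpow (by positivity)]
            exact Real.rpow_le_rpow hW0.le h1 (by linarith)
          calc _ ≤ (1 + n * η) ^ (-(1 - s)) * ((k + 1) * I) := by gcongr
            _ ≤ Q := by rw [mul_comm]; exact le_add_of_nonneg_left hε.le
      calc W * |diagonalMean F z - I| = W ^ s * (W ^ (1 - s) * |diagonalMean F z - I|) := by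
            rw [← mul_assoc, ← hsplit]
        _ ≤ _ := by gcongr
    have hK := continuous_torusKernel (d := d) b n
    have hKi : Integrable (torusKernel (d := d) b n) :=
      hK.integrable_of_hasCompactSupport (HasCompactSupport.of_compactSpace _)
    have hGm : AEStronglyMeasurable
        (fun z : ι → Fin d → UnitAddCircle => (diagonalMean F z : ℂ)) :=
      (Complex.continuous_ofReal.comp_stronglyMeasurable
        (stronglyMeasurable_diagonalMean hF)).aestronglyMeasurable
    have hGK : Integrable fun z : ι → Fin d → UnitAddCircle =>
        (diagonalMean F z : ℂ) * torusKernel b n z := by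
      refine hKi.bdd_mul (c := k * I) hGm (ae_of_all _ fun z => ?_)
      rw [Complex.norm_real, Real.norm_eq_abs, abs_of_nonneg (diagonalMean_nonneg hF0 z)]
      exact diagonalMean_le hF hF0 hFk z
    have hWi : Integrable fun z : ι → Fin d → UnitAddCircle => torusDecay b n z ^ s := by
      refine Continuous.integrable_of_hasCompactSupport ?_ (HasCompactSupport.of_compactSpace _)
      exact (continuous_torusDecay b n).rpow_const fun z => Or.inl (torusDecay_pos b n z).ne'
    rw [integral_prod_density_mul_kernel hF hFi, ← mul_div_assoc, ← sub_div, norm_div, norm_pow,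
      norm_pow, Complex.norm_natCast, ← integral_const_mul,
      ← integral_sub hGK (hKi.const_mul _), div_le_iff₀ (by positivity)]
    calc _ ≤ ∫ z : ι → Fin d → UnitAddCircle,
          (2 * n : ℝ) ^ (d * (N + 1)) * Q * torusDecay b n z ^ s := by
          refine norm_integral_le_of_norm_le (hWi.const_mul _) (ae_of_all _ fun z => ?_)
          rw [← sub_mul, norm_mul, ← Complex.ofReal_sub, Complex.norm_real, Real.norm_eq_abs]
          calc _ ≤ |diagonalMean F z - I| *
                ((2 * n : ℝ) ^ (d * (N + 1)) * torusDecay b n z) := by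
                gcongr; exact norm_torusKernel_le b n z
            _ = (2 * n : ℝ) ^ (d * (N + 1)) *
                (torusDecay b n z * |diagonalMean F z - I|) := by ring
            _ ≤ (2 * n : ℝ) ^ (d * (N + 1)) * (torusDecay b n z ^ s * Q) := by
                exact mul_le_mul_of_nonneg_left (hpt z) (by positivity)
            _ = _ := by ring
      _ ≤ (2 * n : ℝ) ^ (d * (N + 1)) * Q * (C / (n : ℝ) ^ (d * (k - 1))) := by
          rw [integral_const_mul]
          gcongr
          exact hC n hn
      _ = A * Q * ((n : ℝ) ^ d) ^ r := by
          -- The sup bound of the kernel times the mass `n ^ (-d (k - 1))` of the decay product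
          -- matches the normalization exactly.
          have hexp : (n : ℝ) ^ (d * (N + 1)) = ((n : ℝ) ^ d) ^ r * (n : ℝ) ^ (d * (k - 1)) := by
            rw [← pow_mul, ← pow_add, ← mul_add]
            congr 2
            omega
          rw [mul_pow, hexp]
          simp only [A]
          field_simp
  have hdiff : Tendsto (fun n : ℕ =>
      (∫ z : ι → Fin d → UnitAddCircle, ((∏ B, F (z B) : ℝ) : ℂ) * torusKernel b n z) /
        ((n : ℂ) ^ d) ^ r - (I : ℂ) *
      ((∫ z : ι → Fin d → UnitAddCircle, torusKernel b n z) / ((n : ℂ) ^ d) ^ r)) atTop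
      (𝓝 0) := by
    rw [Metric.tendsto_atTop']
    intro ε hε
    -- `A` may vanish, so the division is by `A + 1`.
    obtain ⟨η, hη, hη'⟩ := hbound (ε / (2 * (A + 1))) (by positivity)
    have hlim : Tendsto (fun n : ℕ => A * ((k + 1) * I * (1 + n * η) ^ (-(1 - s)))) atTop
        (𝓝 (A * ((k + 1) * I * 0))) := by
      refine Tendsto.const_mul _ (Tendsto.const_mul _ ?_)
      refine (tendsto_rpow_neg_atTop (by linarith : 0 < 1 - s)).comp ?_
      exact tendsto_atTop_add_const_left _ _
        (tendsto_natCast_atTop_atTop.atTop_mul_const hη)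
    rw [mul_zero, mul_zero] at hlim
    obtain ⟨n₀, hn₀⟩ := eventually_atTop.1
      ((hlim.eventually (gt_mem_nhds (half_pos hε))).and (eventually_gt_atTop 0))
    refine ⟨n₀, fun n hn => ?_⟩
    obtain ⟨h1, h2⟩ := hn₀ n hn.le
    rw [dist_zero_right]
    refine (hη' n h2).trans_lt ?_
    have h3 : A * (ε / (2 * (A + 1))) ≤ ε / 2 := by
      rw [mul_div_assoc', div_le_div_iff₀ (by positivity) (by positivity)]
      nlinarith
    rw [mul_add]
    linarith
  have := hdiff.add hmain
  simpa using this

end TorusKernel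

/-! ### Traces of powers of Gram matrices -/

theorem matrix_pow_succ_apply {κ R : Type*} [Fintype κ] [DecidableEq κ] [CommSemiring R]
    (A : Matrix κ κ R) (N : ℕ) (a c : κ) :
    (A ^ (N + 1)) a c = ∑ q : Fin N → κ, ∏ i : Fin (N + 1),
      A ((Fin.cons a q : Fin (N + 1) → κ) i) ((Fin.snoc q c : Fin (N + 1) → κ) i) := by
  induction N generalizing a with
  | zero => simp [Fin.snoc]
  | succ N ih =>
    rw [pow_succ', Matrix.mul_apply, ← (Fin.consEquiv fun _ => κ).sum_comp,
      Fintype.sum_prod_type]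
    refine Finset.sum_congr rfl fun b _ => ?_
    rw [ih, Finset.mul_sum]
    refine Finset.sum_congr rfl fun q _ => ?_
    have hsnoc : (Fin.snoc ((Fin.consEquiv fun _ => κ) (b, q)) c : Fin (N + 1 + 1) → κ) =
        (Fin.cons b (Fin.snoc q c : Fin (N + 1) → κ) : Fin (N + 1 + 1) → κ) :=
      (Fin.cons_snoc_eq_snoc_cons b q c).symm
    rw [Fin.prod_univ_succ (n := N + 1), hsnoc]
    simp only [Fin.consEquiv_apply, Fin.cons_zero, Fin.cons_succ]

/-- The trace of a matrix power is a sum over closed walks. -/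
theorem trace_pow_succ {κ R : Type*} [Fintype κ] [DecidableEq κ] [CommSemiring R]
    (A : Matrix κ κ R) (N : ℕ) :
    Matrix.trace (A ^ (N + 1)) = ∑ q : Fin (N + 1) → κ, ∏ i, A (q i) (q (i + 1)) := by
  rw [← (Fin.consEquiv fun _ => κ).sum_comp, Fintype.sum_prod_type]
  refine Finset.sum_congr rfl fun a _ => ?_
  rw [Matrix.diag_apply, matrix_pow_succ_apply]
  refine Finset.sum_congr rfl fun q _ => Finset.prod_congr rfl fun i _ => ?_
  simp only [Fin.consEquiv_apply]
  congr 1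
  induction i using Fin.lastCases with
  | last => simp [Fin.last_add_one]
  | cast i => rw [Fin.snoc_castSucc, Fin.coeSucc_eq_succ, Fin.cons_succ]

/-- Allows passing to the Gram matrix indexed by samples, each entry of which involves only two
sample points. -/
theorem trace_mul_pow_comm {κ κ' R : Type*} [Fintype κ] [DecidableEq κ] [Fintype κ']
    [DecidableEq κ'] [CommRing R] (A : Matrix κ κ' R) (B : Matrix κ' κ R) (N : ℕ) :
    Matrix.trace ((A * B) ^ (N + 1)) = Matrix.trace ((B * A) ^ (N + 1)) := by
  have h : ∀ N, (A * B) ^ N * A = A * (B * A) ^ N := by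
    intro N
    induction N with
    | zero => simp
    | succ N ih => rw [pow_succ', Matrix.mul_assoc, ih, pow_succ']; simp only [Matrix.mul_assoc]
  rw [pow_succ, ← Matrix.mul_assoc, h, Matrix.mul_assoc, Matrix.trace_mul_comm, Matrix.mul_assoc,
    ← pow_succ]

theorem gram_apply (d n m : ℕ) (x : ℕ → Fin d → ℝ) (q q' : Fin m) :
    ((vandermonde d n m x).conjTranspose * vandermonde d n m x) q q' =
      (m : ℂ)⁻¹ * ∏ j, dirichlet n (toTorus (Fin d) (x q) j - toTorus (Fin d) (x q') j) := by
  have hentry : ∀ ℓ : Fin d → Fin n,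
      (vandermonde d n m x).conjTranspose q ℓ * vandermonde d n m x ℓ q' =
        (m : ℂ)⁻¹ * ∏ j, Complex.exp
          (2 * Real.pi * Complex.I * (((ℓ j : ℕ) : ℝ) * (x q j - x q' j) : ℝ)) := by
    intro ℓ
    rw [Matrix.conjTranspose_apply, vandermonde, Matrix.of_apply, Matrix.of_apply, star_mul',
      Complex.star_def, Complex.conj_ofReal, ← Complex.exp_conj,
      mul_mul_mul_comm, ← Complex.exp_add, ← Complex.exp_sum]
    congr 1
    · rw [← Complex.ofReal_mul, ← mul_inv, Real.mul_self_sqrt (Nat.cast_nonneg m)]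
      simp
    · congr 1
      simp only [map_mul, map_neg, Complex.conj_ofReal, Complex.conj_I, map_ofNat]
      push_cast
      rw [← Finset.mul_sum]
      simp only [mul_sub, Finset.sum_sub_distrib]
      ring
  rw [Matrix.mul_apply, Finset.sum_congr rfl fun ℓ _ => hentry ℓ, ← Finset.mul_sum]
  congr 1
  have hdir : ∀ j, dirichlet n (toTorus (Fin d) (x q) j - toTorus (Fin d) (x q') j) =
      ∑ ℓ : Fin n, Complex.exp
        (2 * Real.pi * Complex.I * (((ℓ : ℕ) : ℝ) * (x q j - x q' j) : ℝ)) := by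
    intro j
    rw [toTorus, toTorus, ← AddCircle.coe_sub, ← expSum_eq_dirichlet, expSum, Finset.sum_range]
  simp_rw [hdir]
  rw [Finset.prod_univ_sum, Fintype.piFinset_univ]

theorem trace_vandermonde_pow (d n m N : ℕ) (x : ℕ → Fin d → ℝ) :
    Matrix.trace ((vandermonde d n m x * (vandermonde d n m x).conjTranspose) ^ (N + 1)) =
      ((m : ℂ)⁻¹) ^ (N + 1) * ∑ q : Fin (N + 1) → Fin m,
        torusKernel q n fun i : Fin m => toTorus (Fin d) (x i) := by
  rw [trace_mul_pow_comm, trace_pow_succ, Finset.mul_sum]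
  refine Finset.sum_congr rfl fun q _ => ?_
  simp_rw [gram_apply]
  rw [Finset.prod_mul_distrib, Finset.prod_const, Finset.card_univ, Fintype.card_fin, torusKernel,
    Finset.prod_comm]

/-! ### Sums over maps, sorted by their kernel partitions -/

theorem block_eq_iff {p : ℕ} (ω : Partition p) (i j : Fin p) :
    block ω i = block ω j ↔ i ∈ ω.part j := by
  rw [block, block, Subtype.mk.injEq]
  exact (ω.mem_part_iff_part_eq_part (Finset.mem_univ i) (Finset.mem_univ j)).symm

theorem block_surjective {p : ℕ} (ω : Partition p) : Function.Surjective (block ω) := by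
  rintro ⟨B, hB⟩
  obtain ⟨i, hi⟩ := ω.nonempty_of_mem_parts hB
  exact ⟨i, Subtype.ext (ω.part_eq_of_mem hB hi)⟩

theorem partition_ext {p : ℕ} {ω ω' : Partition p} (h : ∀ i, ω.part i = ω'.part i) : ω = ω' := by
  have key : ∀ {ω ω' : Partition p}, (∀ i, ω.part i = ω'.part i) → ω.parts ⊆ ω'.parts := by
    intro ω ω' h B hB
    obtain ⟨i, hi⟩ := block_surjective ω ⟨B, hB⟩
    have : ω.part i = B := congrArg Subtype.val hi
    rw [← this, h i]
    exact ω'.part_mem.2 (Finset.mem_univ i)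
  exact Finpartition.ext (Finset.Subset.antisymm (key h) (key fun i => (h i).symm))

/-- Every map factors uniquely as the quotient by its level sets followed by an injection. -/
theorem bijective_comp_block (p : ℕ) (α : Type*) [DecidableEq α] :
    Function.Bijective
      fun τ : (Σ ω : Partition p, (ω.parts ↪ α)) => fun i => τ.2 (block τ.1 i) := by
  constructor
  · rintro ⟨ω, σ⟩ ⟨ω', σ'⟩ h
    have h' : ∀ i, σ (block ω i) = σ' (block ω' i) := fun i => congrFun h i
    have hω : ω = ω' := by
      refine partition_ext fun i => ?_
      ext j
      rw [← block_eq_iff, ← block_eq_iff, ← σ.injective.eq_iff, ← σ'.injective.eq_iff, h', h']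
    subst hω
    congr 1
    ext B
    obtain ⟨i, rfl⟩ := block_surjective ω B
    exact h' i
  · intro q
    let ω : Partition p := Finpartition.ofSetoid (Setoid.ker q)
    have hω : ∀ i j, block ω i = block ω j ↔ q i = q j := by
      intro i j
      rw [block_eq_iff, Finpartition.mem_part_ofSetoid_iff_rel, Setoid.ker_def]
      exact eq_comm
    let g := Function.surjInv (block_surjective ω)
    have hg : ∀ B, block ω (g B) = B := Function.surjInv_eq (block_surjective ω)
    refine ⟨⟨ω, ⟨fun B => q (g B), fun B B' h => ?_⟩⟩, ?_⟩
    · rw [← hg B, ← hg B', hω]; exact h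
    · ext1 i
      exact (hω _ _).1 (hg _)

theorem sum_eq_sum_partition {p : ℕ} {α M : Type*} [Fintype α] [DecidableEq α] [AddCommMonoid M]
    (φ : (Fin p → α) → M) :
    ∑ q, φ q = ∑ ω : Partition p, ∑ σ : ω.parts ↪ α, φ fun i => σ (block ω i) := by
  rw [← Fintype.sum_sigma', ← (Equiv.ofBijective _ (bijective_comp_block p α)).sum_comp]
  rfl

/-! ### Densities on the torus -/

/-- `f` is only almost everywhere measurable and unconstrained off the cube, so a measurable version
is pulled back along the fundamental domain and its positive part taken. -/
theorem exists_torus_density (d : ℕ) (f : (Fin d → ℝ) → ℝ)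
    (hf : AEMeasurable f (volume.restrict (cube d))) (hf0 : ∀ z ∈ cube d, 0 ≤ f z) :
    ∃ F : (Fin d → UnitAddCircle) → ℝ, Measurable F ∧ (∀ t, 0 ≤ F t) ∧
      (fun z => F (toTorus (Fin d) z)) =ᵐ[volume.restrict (cube d)] f := by
  let e : (Fin d → UnitAddCircle) → Fin d → ℝ :=
    fun t j => (AddCircle.measurableEquivIco (1 : ℝ) (-1 / 2) (t j) : ℝ)
  have he : Measurable e := measurable_pi_lambda _ fun j =>
    measurable_subtype_coe.comp ((AddCircle.measurableEquivIco (1 : ℝ) (-1 / 2)).measurable.comp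
      (measurable_pi_apply j))
  have hez : ∀ z ∈ cube d, e (toTorus (Fin d) z) = z := by
    intro z hz
    ext j
    have hj : z j ∈ Set.Ico (-1 / 2 : ℝ) (-1 / 2 + 1) := by
      have := hz j (Set.mem_univ j)
      rwa [show (-1 / 2 + 1 : ℝ) = 1 / 2 by norm_num]
    exact congrArg Subtype.val (AddCircle.equivIco_coe_eq hj)
  refine ⟨fun t => max (hf.mk f (e t)) 0, (hf.measurable_mk.comp he).max measurable_const,
    fun t => le_max_right _ _, ?_⟩
  have hcube : MeasurableSet (cube d) := MeasurableSet.univ_pi fun _ => measurableSet_Ico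
  filter_upwards [hf.ae_eq_mk, ae_restrict_mem hcube] with z h1 h2
  rw [hez z h2, ← h1, max_eq_left (hf0 z h2)]

theorem map_toTorus_withDensity (d : ℕ) {g : (Fin d → ℝ) → ENNReal}
    {G : (Fin d → UnitAddCircle) → ENNReal} (hG : Measurable G)
    (h : (fun z => G (toTorus (Fin d) z)) =ᵐ[volume.restrict (cube d)] g) :
    ((volume.restrict (cube d)).withDensity g).map (toTorus (Fin d)) = volume.withDensity G := by
  have hmp := measurePreserving_toTorus (Fin d)
  ext s hs
  rw [Measure.map_apply hmp.measurable hs, withDensity_apply _ (hmp.measurable hs),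
    withDensity_apply _ hs, ← hmp.setLIntegral_comp_preimage hs hG]
  exact lintegral_congr_ae (ae_restrict_of_ae h.symm)

theorem pi_withDensity {ι X : Type*} [Fintype ι] [MeasureSpace X]
    [IsProbabilityMeasure (volume : Measure X)] {g : X → ENNReal} (hg : Measurable g)
    [SigmaFinite (volume.withDensity g)] :
    Measure.pi (fun _ : ι => volume.withDensity g) =
      (volume : Measure (ι → X)).withDensity fun z => ∏ i, g (z i) := by
  refine Measure.pi_eq fun s hs => ?_
  rw [withDensity_apply _ (MeasurableSet.univ_pi hs),
    ← lintegral_indicator (MeasurableSet.univ_pi hs)]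
  have hind : (Set.univ.pi s).indicator (fun z : ι → X => ∏ i, g (z i)) =
      fun z => ∏ i, (s i).indicator g (z i) := by
    classical
    ext z
    by_cases hz : z ∈ Set.univ.pi s
    · rw [Set.indicator_of_mem hz]
      exact Finset.prod_congr rfl fun i _ =>
        (Set.indicator_of_mem (hz i (Set.mem_univ i)) g).symm
    · rw [Set.indicator_of_notMem hz]
      simp only [Set.mem_pi, Set.mem_univ, true_implies, not_forall] at hz
      obtain ⟨i, hi⟩ := hz
      exact (Finset.prod_eq_zero (Finset.mem_univ i) (Set.indicator_of_notMem hi g)).symm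
  rw [hind, lintegral_fintype_prod_eq _ fun i => hg.indicator (hs i)]
  exact Finset.prod_congr rfl fun i _ => by
    rw [withDensity_apply _ (hs i), lintegral_indicator (hs i)]

/-- Expectations over distinct samples are integrals against the product density. -/
theorem integral_comp_samples {Ω : Type*} [MeasurableSpace Ω] {P : Measure Ω}
    [IsProbabilityMeasure P] {d : ℕ} {ξ : ℕ → Ω → Fin d → UnitAddCircle}
    (hξ : ∀ q, Measurable (ξ q)) (hindep : iIndepFun ξ P)
    {F : (Fin d → UnitAddCircle) → ℝ} (hF : Measurable F) (hF0 : ∀ t, 0 ≤ F t)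
    (hlaw : ∀ q, P.map (ξ q) = volume.withDensity fun t => ENNReal.ofReal (F t))
    {ι : Type*} [Fintype ι] (σ : ι → ℕ) (hσ : Function.Injective σ)
    {K : (ι → Fin d → UnitAddCircle) → ℂ} (hK : Continuous K) :
    ∫ a, K (fun B => ξ (σ B) a) ∂P =
      ∫ z : ι → Fin d → UnitAddCircle, ((∏ B, F (z B) : ℝ) : ℂ) * K z := by
  have hprob : IsProbabilityMeasure
      ((volume : Measure (Fin d → UnitAddCircle)).withDensity fun t => ENNReal.ofReal (F t)) := by
    rw [← hlaw 0]; exact Measure.isProbabilityMeasure_map (hξ 0).aemeasurable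
  have hmap : P.map (fun a B => ξ (σ B) a) =
      volume.withDensity fun z : ι → Fin d → UnitAddCircle => ∏ B, ENNReal.ofReal (F (z B)) := by
    rw [(iIndepFun_iff_map_fun_eq_pi_map fun B => (hξ (σ B)).aemeasurable).1
      (hindep.precomp hσ)]
    simp_rw [hlaw]
    exact pi_withDensity (by fun_prop)
  rw [← integral_map (f := K) (φ := fun a B => ξ (σ B) a) (by fun_prop)
    hK.aestronglyMeasurable, hmap, integral_withDensity_eq_integral_toReal_smul]
  · refine integral_congr_ae (ae_of_all _ fun z => ?_)
    simp only [Complex.real_smul]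
    rw [← ENNReal.ofReal_prod_of_nonneg fun B _ => hF0 _,
      ENNReal.toReal_ofReal (Finset.prod_nonneg fun B _ => hF0 _)]
  · exact Finset.measurable_prod _ fun B _ => by fun_prop
  · exact ae_of_all _ fun z => ENNReal.prod_lt_top fun B _ => ENNReal.ofReal_lt_top

/-! ### Assembly -/

theorem uniformMean_eq {N : ℕ} (ω : Partition (N + 1)) (n : ℕ) :
    uniformMean ω n =
      (∫ y : ω.parts → UnitAddCircle,
        ∏ i, dirichlet n (y (block ω i) - y (block ω (i + 1)))) /
        (n : ℂ) ^ (N + 1 - Fintype.card ω.parts + 1) := by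
  have hmp := measurePreserving_toTorus ω.parts
  have hd := continuous_dirichlet n
  rw [uniformMean, Fintype.card_coe, ← hmp.map_eq, integral_map hmp.aemeasurable]
  · congr 1
    refine integral_congr_ae (ae_of_all _ fun y => ?_)
    simp only [cyclicKernel, finRotate_apply, expSum_eq_dirichlet, toTorus,
      AddCircle.coe_sub]
  · exact Continuous.aestronglyMeasurable (by fun_prop)

theorem tendsto_uniformMean {N : ℕ} (ω : Partition (N + 1)) :
    Tendsto (uniformMean ω) atTop (𝓝 ((coeff ω : ℝ) : ℂ)) := by
  obtain ⟨v, hv⟩ := exists_tendsto_integral_prod_dirichlet (block ω) (block_surjective ω)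
  -- The limit is already known to be real, so the real part in `coeff` discards nothing.
  have hv' : Tendsto (uniformMean ω) atTop (𝓝 (v : ℂ)) :=
    hv.congr fun n => (uniformMean_eq ω n).symm
  rwa [coeff, hv'.limUnder_eq, Complex.ofReal_re]

theorem tendsto_descFactorial_div_pow (k : ℕ) :
    Tendsto (fun m : ℕ => (m.descFactorial k : ℂ) / (m : ℂ) ^ k) atTop (𝓝 1) := by
  induction k with
  | zero => simp
  | succ k ih =>
    have h1 : Tendsto (fun m : ℕ => 1 - (k : ℂ) * (1 / (m : ℂ))) atTop (𝓝 (1 - k * 0)) :=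
      tendsto_const_nhds.sub (tendsto_one_div_atTop_nhds_zero_nat.const_mul _)
    have h2 := h1.mul ih
    rw [mul_zero, sub_zero, mul_one] at h2
    refine h2.congr' ?_
    filter_upwards [eventually_gt_atTop k] with m hm
    have hm0 : (m : ℂ) ≠ 0 := by
      exact_mod_cast (Nat.zero_lt_of_lt hm).ne'
    rw [Nat.descFactorial_succ, Nat.cast_mul, Nat.cast_sub hm.le, pow_succ]
    field_simp

/-- Distinct blocks carry distinct, hence independent, samples, so the expectation depends only on
`ω`; the falling factorial counts the labellings, and is zero if there are more blocks than samples.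
-/
theorem moment_eq {Ω : Type*} [MeasurableSpace Ω] {P : Measure Ω} [IsProbabilityMeasure P]
    {d : ℕ} {x : ℕ → Ω → Fin d → ℝ} (hx : ∀ q, Measurable (x q)) (hindep : iIndepFun x P)
    {F : (Fin d → UnitAddCircle) → ℝ} (hF : Measurable F) (hF0 : ∀ t, 0 ≤ F t)
    (hlaw : ∀ q, P.map (fun a => toTorus (Fin d) (x q a)) =
      volume.withDensity fun t => ENNReal.ofReal (F t)) (N n m : ℕ) :
    moment P d (N + 1) n m x = ((n : ℂ) ^ d)⁻¹ * (((m : ℂ)⁻¹) ^ (N + 1) *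
      ∑ ω : Partition (N + 1), (m.descFactorial (Fintype.card ω.parts) : ℂ) *
        ∫ z : ω.parts → Fin d → UnitAddCircle,
          ((∏ B, F (z B) : ℝ) : ℂ) * torusKernel (block ω) n z) := by
  have htm : Measurable (toTorus (Fin d)) := (measurePreserving_toTorus (Fin d)).measurable
  have hξ : ∀ q, Measurable fun a => toTorus (Fin d) (x q a) := fun q => htm.comp (hx q)
  have hξi : iIndepFun (fun q a => toTorus (Fin d) (x q a)) P :=
    hindep.comp (fun _ => toTorus (Fin d)) fun _ => htm
  have hint : ∀ q : Fin (N + 1) → Fin m, Integrable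
      (fun a => torusKernel q n fun i : Fin m => toTorus (Fin d) (x i a)) P := by
    intro q
    refine Integrable.of_bound ?_ ((2 * n : ℝ) ^ (d * (N + 1))) (ae_of_all _ fun a => ?_)
    · refine ((continuous_torusKernel q n).measurable.comp ?_).aestronglyMeasurable
      exact measurable_pi_lambda _ fun i => hξ i
    · refine (norm_torusKernel_le q n _).trans ?_
      exact mul_le_of_le_one_right (by positivity) (torusDecay_le_one q n _)
  unfold moment
  simp_rw [trace_vandermonde_pow]
  rw [integral_const_mul, integral_const_mul, integral_finsetSum _ fun q _ => hint q,
    sum_eq_sum_partition]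
  congr 2
  refine Finset.sum_congr rfl fun ω _ => ?_
  have hσ : ∀ σ : ω.parts ↪ Fin m,
      ∫ a, torusKernel (fun i => σ (block ω i)) n
        (fun i : Fin m => toTorus (Fin d) (x i a)) ∂P =
      ∫ z : ω.parts → Fin d → UnitAddCircle,
          ((∏ B, F (z B) : ℝ) : ℂ) * torusKernel (block ω) n z := fun σ =>
    integral_comp_samples hξ hξi hF hF0 hlaw (fun B => (σ B : ℕ))
      (Fin.val_injective.comp σ.injective) (continuous_torusKernel (block ω) n)
  rw [Finset.sum_congr rfl fun σ _ => hσ σ, Finset.sum_const, Finset.card_univ,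
    Fintype.card_embedding_eq, Fintype.card_fin, nsmul_eq_mul]

theorem sum_partitions_eq {p : ℕ} (hp : 1 ≤ p) (c : ℕ → ℝ) (u : Partition p → ℝ) :
    ∑ ω : Partition p, c ω.parts.card * u ω =
      ∑ k ∈ Finset.Icc 1 p, c k * ∑ ω ∈ partitionsInto p k, u ω := by
  have hmem : ∀ ω ∈ (Finset.univ : Finset (Partition p)), ω.parts.card ∈ Finset.Icc 1 p := by
    intro ω _
    have h1 := Fintype.card_le_of_surjective _ (block_surjective ω)
    rw [Fintype.card_coe, Fintype.card_fin] at h1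
    exact Finset.mem_Icc.2 ⟨Finset.card_pos.2 ⟨_, (block ω ⟨0, hp⟩).2⟩, h1⟩
  rw [← Finset.sum_fiberwise_of_maps_to hmem]
  refine Finset.sum_congr rfl fun k _ => ?_
  rw [partitionsInto, Finset.mul_sum]
  exact Finset.sum_congr rfl fun ω hω => by rw [(Finset.mem_filter.1 hω).2]

end RandomVandermonde

end

/-- The first conjunct says that the limits defining the coefficients `v(ω)` exist and are real. -/
theorem theorem1 (d p : ℕ) (hd : 1 ≤ d) (hp : 1 ≤ p)
    {Ω : Type*} [MeasurableSpace Ω] (P : Measure Ω) [IsProbabilityMeasure P]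
    (f : (Fin d → ℝ) → ℝ)
    (hf : AEMeasurable f (volume.restrict (RandomVandermonde.cube d)))
    (hf0 : ∀ z ∈ RandomVandermonde.cube d, 0 ≤ f z)
    (hfp : IntegrableOn (fun z => f z ^ p) (RandomVandermonde.cube d))
    (x : ℕ → Ω → Fin d → ℝ) (hx : ∀ q, Measurable (x q))
    (hindep : iIndepFun x P)
    (hlaw : ∀ q, P.map (x q) =
      (volume.restrict (RandomVandermonde.cube d)).withDensity fun z => ENNReal.ofReal (f z))
    (β : ℝ) (hβ : 0 < β) (n m : ℕ → ℕ)
    (hn : Tendsto n atTop atTop) (hm : Tendsto m atTop atTop)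
    (hnm : Tendsto (fun t => ((n t : ℝ) ^ d) / (m t : ℝ)) atTop (𝓝 β)) :
    (∀ ω : RandomVandermonde.Partition p,
      Tendsto (RandomVandermonde.uniformMean ω) atTop
        (𝓝 ((RandomVandermonde.coeff ω : ℝ) : ℂ))) ∧
    Tendsto (fun t => RandomVandermonde.moment P d p (n t) (m t) x) atTop
      (𝓝 ((∑ k ∈ Finset.Icc 1 p, β ^ (p - k) * RandomVandermonde.powerIntegral d f k *
        ∑ ω ∈ RandomVandermonde.partitionsInto p k, RandomVandermonde.coeff ω ^ d : ℝ) : ℂ)) := by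
  obtain ⟨N, rfl⟩ : ∃ N, p = N + 1 := ⟨p - 1, by omega⟩
  refine ⟨RandomVandermonde.tendsto_uniformMean, ?_⟩
  have hmp := RandomVandermonde.measurePreserving_toTorus (Fin d)
  obtain ⟨F, hFm, hF0, hFf⟩ := RandomVandermonde.exists_torus_density d f hf hf0
  have hlawF : ∀ q, P.map (fun a => RandomVandermonde.toTorus (Fin d) (x q a)) =
      volume.withDensity fun t => ENNReal.ofReal (F t) := by
    intro q
    have h1 := Measure.map_map (μ := P) hmp.measurable (hx q)
    rw [hlaw q, RandomVandermonde.map_toTorus_withDensity d (G := fun t => ENNReal.ofReal (F t))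
      (by fun_prop) (by filter_upwards [hFf] with z hz; rw [hz])] at h1
    exact h1.symm
  -- The integral of `F` is the total mass of the law of a sample, hence finite.
  have hFi : Integrable F := by
    refine ⟨hFm.aestronglyMeasurable, ?_⟩
    rw [hasFiniteIntegral_iff_ofReal (ae_of_all _ hF0)]
    have h1 := congrArg (fun μ : Measure (Fin d → UnitAddCircle) => μ Set.univ) (hlawF 0)
    simp only [withDensity_apply _ MeasurableSet.univ, Measure.restrict_univ] at h1
    rw [← h1]
    exact measure_lt_top _ _
  have hFp : Integrable fun t => F t ^ (N + 1) := by
    rw [← hmp.integrable_comp (by fun_prop)]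
    refine Integrable.congr hfp ?_
    filter_upwards [hFf] with z hz
    simp [hz]
  -- Intermediate powers are controlled pointwise by `F + F ^ (N + 1)`.
  have hFk : ∀ k, 1 ≤ k → k ≤ N + 1 → Integrable fun t => F t ^ k := by
    intro k hk1 hk
    refine (hFi.add hFp).mono' (by fun_prop) (ae_of_all _ fun t => ?_)
    rw [Real.norm_eq_abs, abs_of_nonneg (pow_nonneg (hF0 t) _), Pi.add_apply]
    rcases le_total (F t) 1 with h | h
    · have h1 := pow_le_pow_of_le_one (hF0 t) h hk1
      rw [pow_one] at h1
      exact h1.trans (le_add_of_nonneg_right (pow_nonneg (hF0 t) _))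
    · exact (pow_le_pow_right₀ h hk).trans (le_add_of_nonneg_left (hF0 t))
  have hIk : ∀ k, ∫ t, F t ^ k = RandomVandermonde.powerIntegral d f k := by
    intro k
    rw [← hmp.map_eq, integral_map hmp.aemeasurable (by fun_prop)]
    refine integral_congr_ae ?_
    filter_upwards [hFf] with z hz
    simp [hz]
  -- With `k` blocks, the weight `n ^ (-d) * m ^ (-(N + 1))` is split as `m ^ (-k) * (n ^ d / m) ^
  -- (N + 1 - k) * (n ^ d) ^ (-(N + 1 - k + 1))`, so that each of the three factors converges
  -- separately.
  have hterm : ∀ ω : RandomVandermonde.Partition (N + 1), Tendsto (fun t =>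
      (((m t).descFactorial (Fintype.card ω.parts) : ℂ) / (m t : ℂ) ^ Fintype.card ω.parts) *
      (((n t : ℂ) ^ d) / (m t : ℂ)) ^ (N + 1 - Fintype.card ω.parts) *
      ((∫ z : ω.parts → Fin d → UnitAddCircle, ((∏ B, F (z B) : ℝ) : ℂ) *
        RandomVandermonde.torusKernel (RandomVandermonde.block ω) (n t) z) /
        ((n t : ℂ) ^ d) ^ (N + 1 - Fintype.card ω.parts + 1))) atTop
      (𝓝 ((β ^ (N + 1 - ω.parts.card) * RandomVandermonde.powerIntegral d f ω.parts.card *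
        RandomVandermonde.coeff ω ^ d : ℝ) : ℂ)) := by
    intro ω
    have hb := RandomVandermonde.block_surjective ω
    have hcard := Fintype.card_le_of_surjective _ hb
    rw [Fintype.card_fin] at hcard
    have : Nonempty ω.parts := ⟨RandomVandermonde.block ω 0⟩
    have h1 := (RandomVandermonde.tendsto_descFactorial_div_pow (Fintype.card ω.parts)).comp hm
    have h2 : Tendsto (fun t => ((n t : ℂ) ^ d) / (m t : ℂ)) atTop (𝓝 (β : ℂ)) := by
      refine ((Complex.continuous_ofReal.tendsto β).comp hnm).congr fun t => ?_
      simp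
    have h3 := (RandomVandermonde.tendsto_integral_prod_density_mul_kernel hFm hF0 hFi
      (hFk _ Fintype.card_pos hcard) _ hb
      ((RandomVandermonde.tendsto_uniformMean ω).congr
        (RandomVandermonde.uniformMean_eq ω))).comp hn
    have h4 := (h1.mul (h2.pow (N + 1 - Fintype.card ω.parts))).mul h3
    rw [hIk, Fintype.card_coe] at h4
    have hlim : ((β ^ (N + 1 - ω.parts.card) * RandomVandermonde.powerIntegral d f ω.parts.card *
        RandomVandermonde.coeff ω ^ d : ℝ) : ℂ) = 1 * (β : ℂ) ^ (N + 1 - ω.parts.card) *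
        ((RandomVandermonde.powerIntegral d f ω.parts.card * RandomVandermonde.coeff ω ^ d : ℝ) :
          ℂ) := by
      push_cast; ring
    rw [hlim, Fintype.card_coe]
    exact h4
  rw [← RandomVandermonde.sum_partitions_eq hp
    (fun k => β ^ (N + 1 - k) * RandomVandermonde.powerIntegral d f k), Complex.ofReal_sum]
  refine (tendsto_finsetSum _ fun ω _ => hterm ω).congr' ?_
  filter_upwards [hn.eventually (eventually_gt_atTop 0), hm.eventually (eventually_gt_atTop 0)]
    with t hnt hmt
  have hn0 : ((n t : ℂ) ^ d) ≠ 0 := pow_ne_zero _ (by exact_mod_cast hnt.ne')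
  have hm0 : (m t : ℂ) ≠ 0 := by exact_mod_cast hmt.ne'
  rw [RandomVandermonde.moment_eq hx hindep hFm hF0 hlawF, Finset.mul_sum, Finset.mul_sum]
  refine Finset.sum_congr rfl fun ω _ => ?_
  have hcard := Fintype.card_le_of_surjective _ (RandomVandermonde.block_surjective ω)
  rw [Fintype.card_fin] at hcard
  generalize (∫ z : ω.parts → Fin d → UnitAddCircle, ((∏ B, F (z B) : ℝ) : ℂ) *
    RandomVandermonde.torusKernel (RandomVandermonde.block ω) (n t) z) = E
  generalize Fintype.card ω.parts = k at hcard ⊢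
  obtain ⟨r, hr⟩ := Nat.exists_eq_add_of_le hcard
  rw [hr, Nat.add_sub_cancel_left, inv_pow, pow_add, pow_succ, div_pow]
  field_simp
  ring
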